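/- For $\theta>0$ let $f_\theta(x)=x^{\theta-1}e^{-x}/\Gamma(\theta)$, $x>0$, be the Gamma$(\theta,1)$ density, and let $P_\theta$, $E_\theta$ denote probability and expectation when $X_1,X_2,\dots$ are i.i.d. Gamma$(\theta,1)$. For $\theta,\varphi>0$ define the Fisher and Kullback–Leibler information numbers $$I(\theta)=-E_\theta\Big[\frac{\partial^2}{\partial\theta^2}\log f_\theta(X_1)\Big]=\frac{d^2}{d\theta^2}\log\Gamma(\theta),\qquad I(\theta,\varphi)=E_\theta\log\frac{f_\theta(X_1)}{f_\varphi(X_1)}=(\theta-\varphi)\frac{d}{d\theta}\log\Gamma(\theta)-\log\frac{\Gamma(\theta)}{\Gamma(\varphi)}.$$ Fix $\theta_0>0$. For $n\ge1$ let $\theta_n$ be an estimator of the shape parameter that is measurable with respect to $F_{n-1}=\sigma(X_1,\dots,X_{n-1})$ ($F_0$ trivial), and put $$\Lambda_n=\prod_{i=1}^n\frac{X_i^{\theta_i-\theta_0}\,\Gamma(\theta_0)}{\Gamma(\theta_i)},\qquad \tau_b=\min\{n\ge1:\Lambda_n\ge e^b\}\quad(\tau_b=\infty\text{ if there is no such }n).$$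 Let $\theta>0$, $\theta\ne\theta_0$, be such that every $\theta_n$ is $P_\theta$-almost surely positive and the following hold. 1. The sequence has asymptotic efficiency $\kappa(\theta)\in(0,\infty)$ at $\theta$: $E_\theta(\theta_n-\theta)^2=(1+o(1))/[nI(\theta)\kappa(\theta)]$ as $n\to\infty$. 2. $E_\theta(\theta_n-\theta)^4$ is finite for every $n\ge1$, and is $O(n^{-2})$ as $n\to\infty$. 3. There is $c>0$, which may depend on $\theta$, such that $\sum_{n=1}^\infty E_\theta\big[(\log\theta_n^{-1})^+\mathbf 1(\theta_n<c)\big]<\infty$. Then $E_\theta\tau_b<\infty$ for every $b$, and, as $b\to\infty$, $$E_\theta\tau_b=I(\theta,\theta_0)^{-1}\Big(b+\frac{\log b}{2\kappa(\theta)}\Big)+o(\log b).$$ -/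

import Mathlib

open MeasureTheory ProbabilityTheory Filter Asymptotics
open scoped ENNReal Topology

noncomputable section

namespace GammaShape

variable {Ω : Type*}

/-- `past X n` is the σ-field `F_{n-1} = σ(X 1, …, X (n-1))`; it is trivial for `n = 1`. -/
@[reducible] def past (X : ℕ → Ω → ℝ) (n : ℕ) : MeasurableSpace Ω :=
  ⨆ k ∈ Finset.Ico 1 n, MeasurableSpace.comap (X k) inferInstance

/-- The estimated likelihood ratio
`Λ_n = ∏_{i=1}^n X_i ^ (θ_i - θ₀) * Γ(θ₀) / Γ(θ_i)`, with `est i` in the role of `θ_i`. -/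
def likelihoodRatio (θ₀ : ℝ) (X est : ℕ → Ω → ℝ) (n : ℕ) (ω : Ω) : ℝ :=
  ∏ i ∈ Finset.Icc 1 n,
    ((X i ω) ^ (est i ω - θ₀) * Real.Gamma θ₀ / Real.Gamma (est i ω))

/-- `τ_b = min {n ≥ 1 : Λ_n ≥ e ^ b}`, equal to `∞` if there is no such `n`. -/
def stoppingTime (θ₀ : ℝ) (X est : ℕ → Ω → ℝ) (b : ℝ) (ω : Ω) : ℕ∞ :=
  ⨅ n : ℕ, ⨅ _ : 1 ≤ n ∧ Real.exp b ≤ likelihoodRatio θ₀ X est n ω, (n : ℕ∞)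

/-- The expectation, with values in `[0, ∞]`, of `τ_b` under `μ`. -/
def expectedStoppingTime [MeasurableSpace Ω] (μ : Measure Ω) (θ₀ : ℝ) (X est : ℕ → Ω → ℝ)
    (b : ℝ) : ℝ≥0∞ :=
  ∫⁻ ω, (stoppingTime θ₀ X est b ω : ℝ≥0∞) ∂μ

/-- Fisher information `I(θ) = -E_θ[∂² log f_θ(X) / ∂θ²]` of the Gamma(θ, 1) family. -/
def fisherInfo (θ : ℝ) : ℝ :=
  -∫ x, iteratedDeriv 2 (fun t => Real.log (gammaPDFReal t 1 x)) θ ∂(gammaMeasure θ 1)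

/-- Kullback–Leibler information `I(θ, φ) = E_θ log (f_θ(X) / f_φ(X))` of the
Gamma(θ, 1) family. -/
def klInfo (θ φ : ℝ) : ℝ :=
  ∫ x, Real.log (gammaPDFReal θ 1 x / gammaPDFReal φ 1 x) ∂(gammaMeasure θ 1)

end GammaShape

end

/-! Almost surely `log Λ_n` is a random walk with small perturbations. With ψ = (log Γ)'(θ), its
n-th increment is I(θ,θ₀) + (θ-θ₀)(log X_n - ψ) + (θ_n-θ)(log X_n - ψ) - I(θ,θ_n): a constant drift
plus centred noise, a martingale difference whose coefficient is the estimation error, and a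
nonnegative predictable loss. A second order expansion at θ gives E I(θ,θ_n) ≈ (I(θ)/2) E(θ_n-θ)² ≈
1/(2κn), so the loss accumulated over m steps has mean about log m/(2κ). Optional stopping gives
I(θ,θ₀) E τ_b = b + E(overshoot) + E(loss up to τ_b), and τ_b is of order b. Two facts remain: the
mean overshoot is o(log b), and the mean loss up to the random time τ_b is log b/(2κ) + o(log b).

The loss: by the fourth moments, the squared error at time n has integral at most r P(A) + C/(r n²)
over any event A, for every r > 0 (`TailControl`); the loss inherits this up to a summable error.
Hence the loss on {τ_b > n}, summed over n, exceeds the unconditional sum over n ≤ E τ_b by a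
bounded amount at most (`TailControl.sum_setIntegral_le`). Conversely P(τ_b ≤ δb) = O(δ), and on
such a small event the loss of the first δb steps is at most ε log b + O(1) in mean
(`TailControl.sum_setIntegral_le_log`).

The overshoot: it is at most the positive part of the crossing increment, of mean J. Apart from
increments with an exponentially small tail and from those dominated by the error term, a crossing
increment comes after the lower level b - O(log b) has been reached. The expected time spent between
the two levels is itself O(J + log b), so a second moment bound with a free parameter r yields J ≤
3r + O(J + log b)/r + O(1), which is solved for J with r large (`exists_jumpMean_le`).

All bounds are proved for τ_b truncated at N, uniformly in N, so that E τ_b < ∞ is an output. The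
abstract result is `PerturbedWalk.isLittleO_crossing`; `exists_perturbedWalk` supplies the Gamma
case. -/

noncomputable section

namespace GammaShape

variable {Ω : Type*}

/-! ### Nonnegative sequences of order `1 / n` in mean, uniformly integrable in a strong sense -/

/-- A sequence of nonnegative integrable functions `h i` which, up to a summable error, are dominated
in mean by `r + C / (r * (i + 1) ^ 2)` for every `r > 0`, uniformly on measurable sets. -/
structure TailControl [MeasurableSpace Ω] (μ : Measure Ω) (h : ℕ → Ω → ℝ) (C : ℝ) (η : ℕ → ℝ) :
    Prop where
  C_nonneg : 0 ≤ C
  η_nonneg : ∀ i, 0 ≤ η i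
  summable_η : Summable η
  nonneg : ∀ i ω, 0 ≤ h i ω
  integrable : ∀ i, Integrable (h i) μ
  setIntegral_le : ∀ i s r, MeasurableSet s → 0 < r →
    ∫ ω in s, h i ω ∂μ ≤ r * μ.real s + C / (r * ((i : ℝ) + 1) ^ 2) + η i

lemma sum_inv_succ_le_one_add_log (m : ℕ) :
    ∑ i ∈ Finset.range m, ((i : ℝ) + 1)⁻¹ ≤ 1 + Real.log m := by
  have h := harmonic_le_one_add_log m
  simpa [harmonic] using h

lemma sum_Ico_inv_succ_sq_le {m : ℕ} (hm : 1 ≤ m) (N : ℕ) :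
    ∑ i ∈ Finset.Ico m N, (((i : ℝ) + 1) ^ 2)⁻¹ ≤ (m : ℝ)⁻¹ := by
  rcases le_total m N with h | h
  · have h1 := sum_Ioc_inv_sq_le_sub (α := ℝ) (k := m) (n := N) (by omega) h
    have h2 : ∑ i ∈ Finset.Ico m N, (((i : ℝ) + 1) ^ 2)⁻¹
        = ∑ i ∈ Finset.Ioc m N, (((i : ℝ)) ^ 2)⁻¹ := by
      have := Finset.sum_Ico_add' (fun i : ℕ => ((i : ℝ) ^ 2)⁻¹) m N 1
      rw [← Finset.Ico_add_one_add_one_eq_Ioc, ← this]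
      push_cast
      rfl
    rw [h2]
    refine h1.trans ?_
    simp
  · simp [Finset.Ico_eq_empty_of_le h]

namespace TailControl

variable [MeasurableSpace Ω] {μ : Measure Ω} {h : ℕ → Ω → ℝ} {C : ℝ}
  {η : ℕ → ℝ}

lemma setIntegral_nonneg (H : TailControl μ h C η) (i : ℕ) (s : Set Ω) :
    0 ≤ ∫ ω in s, h i ω ∂μ :=
  integral_nonneg (H.nonneg i)

lemma setIntegral_mono (H : TailControl μ h C η) (i : ℕ) {s t : Set Ω} (hst : s ⊆ t) :
    ∫ ω in s, h i ω ∂μ ≤ ∫ ω in t, h i ω ∂μ :=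
  setIntegral_mono_set (H.integrable i).integrableOn (ae_of_all _ (H.nonneg i))
    hst.eventuallyLE

lemma setIntegral_le_integral (H : TailControl μ h C η) (i : ℕ) (s : Set Ω) :
    ∫ ω in s, h i ω ∂μ ≤ ∫ ω, h i ω ∂μ :=
  MeasureTheory.setIntegral_le_integral (H.integrable i) (ae_of_all _ (H.nonneg i))

lemma tsum_nonneg (H : TailControl μ h C η) : 0 ≤ ∑' i, η i := _root_.tsum_nonneg H.η_nonneg

/-- Over sets of total mass at most `m`, only the first `m` terms matter. -/
lemma sum_setIntegral_le (H : TailControl μ h C η) {B : ℕ → Set Ω}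
    (hB : ∀ i, MeasurableSet (B i)) {N m : ℕ} (hm : 1 ≤ m)
    (hmass : ∑ i ∈ Finset.range N, μ.real (B i) ≤ m) :
    ∑ i ∈ Finset.range N, ∫ ω in B i, h i ω ∂μ
      ≤ ∑ i ∈ Finset.range m, ∫ ω, h i ω ∂μ + (1 + C + ∑' i, η i) := by
  have hm0 : (0 : ℝ) < m := by exact_mod_cast hm
  have hC := H.C_nonneg
  have hle : ∑ i ∈ Finset.range N, ∫ ω in B i, h i ω ∂μ
      ≤ ∑ i ∈ Finset.range m, ∫ ω in B i, h i ω ∂μ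
        + ∑ i ∈ Finset.Ico m N, ∫ ω in B i, h i ω ∂μ := by
    rcases le_total m N with hmN | hmN
    · rw [Finset.sum_range_add_sum_Ico _ hmN]
    · rw [Finset.Ico_eq_empty_of_le hmN, Finset.sum_empty, add_zero]
      exact Finset.sum_le_sum_of_subset_of_nonneg (Finset.range_mono hmN)
        fun i _ _ => H.setIntegral_nonneg i _
  have h1 : ∑ i ∈ Finset.range m, ∫ ω in B i, h i ω ∂μ
      ≤ ∑ i ∈ Finset.range m, ∫ ω, h i ω ∂μ :=
    Finset.sum_le_sum fun i _ => H.setIntegral_le_integral i _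
  have h2 : ∑ i ∈ Finset.Ico m N, ∫ ω in B i, h i ω ∂μ
      ≤ ∑ i ∈ Finset.Ico m N, ((m : ℝ)⁻¹ * μ.real (B i)
        + C * m * (((i : ℝ) + 1) ^ 2)⁻¹ + η i) := by
    refine Finset.sum_le_sum fun i _ => ?_
    -- The choice r = 1/m balances the two terms: r times the total mass is at most 1, and C·m·∑_{i
    -- ≥ m} (i+1)⁻² is at most C.
    refine (H.setIntegral_le i (B i) (m : ℝ)⁻¹ (hB i) (by positivity)).trans (le_of_eq ?_)
    field_simp
  have h3 : ∑ i ∈ Finset.Ico m N, μ.real (B i) ≤ m := by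
    refine le_trans (Finset.sum_le_sum_of_subset_of_nonneg ?_ fun _ _ _ => measureReal_nonneg) hmass
    intro i hi
    simp only [Finset.mem_Ico, Finset.mem_range] at hi ⊢
    omega
  have h4 : ∑ i ∈ Finset.Ico m N, η i ≤ ∑' i, η i :=
    H.summable_η.sum_le_tsum _ fun i _ => H.η_nonneg i
  have h5 := sum_Ico_inv_succ_sq_le hm N
  rw [Finset.sum_add_distrib, Finset.sum_add_distrib, ← Finset.mul_sum, ← Finset.mul_sum] at h2
  have h6 : (m : ℝ)⁻¹ * ∑ i ∈ Finset.Ico m N, μ.real (B i) ≤ 1 := by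
    rw [inv_mul_le_iff₀ hm0]
    simpa using h3
  have h7 : C * m * ∑ i ∈ Finset.Ico m N, (((i : ℝ) + 1) ^ 2)⁻¹ ≤ C := by
    refine (mul_le_mul_of_nonneg_left h5 (by positivity)).trans (le_of_eq ?_)
    field_simp
  linarith

/-- On a set of small mass, the first `m` terms contribute a small multiple of `log m`. -/
lemma sum_setIntegral_le_log (H : TailControl μ h C η) {s : Set Ω} (hs : MeasurableSet s) {γ : ℝ}
    (hγ : 0 < γ) (hsγ : μ.real s ≤ γ ^ 2) (m : ℕ) :
    ∑ i ∈ Finset.range m, ∫ ω in s, h i ω ∂μ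
      ≤ (1 + C) * γ * (1 + Real.log m) + ∑' i, η i := by
  have hC := H.C_nonneg
  calc ∑ i ∈ Finset.range m, ∫ ω in s, h i ω ∂μ
      ≤ ∑ i ∈ Finset.range m, ((1 + C) * γ * ((i : ℝ) + 1)⁻¹ + η i) := by
        refine Finset.sum_le_sum fun i _ => ?_
        have hi : (0 : ℝ) < (i : ℝ) + 1 := by positivity
        -- With r = 1/(γ(i+1)) and mass at most γ², both terms become multiples of γ/(i+1), and the
        -- harmonic sum gives the logarithm.
        have h1 := H.setIntegral_le i s (γ⁻¹ * ((i : ℝ) + 1)⁻¹) hs (by positivity)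
        have h2 : γ⁻¹ * ((i : ℝ) + 1)⁻¹ * μ.real s ≤ γ * ((i : ℝ) + 1)⁻¹ := by
          calc γ⁻¹ * ((i : ℝ) + 1)⁻¹ * μ.real s ≤ γ⁻¹ * ((i : ℝ) + 1)⁻¹ * γ ^ 2 := by gcongr
            _ = γ * ((i : ℝ) + 1)⁻¹ := by field_simp
        have h3 : C / (γ⁻¹ * ((i : ℝ) + 1)⁻¹ * ((i : ℝ) + 1) ^ 2) = C * γ * ((i : ℝ) + 1)⁻¹ := by
          field_simp
        rw [h3] at h1
        linarith
    _ = (1 + C) * γ * ∑ i ∈ Finset.range m, ((i : ℝ) + 1)⁻¹ + ∑ i ∈ Finset.range m, η i := by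
        rw [Finset.sum_add_distrib, ← Finset.mul_sum]
    _ ≤ _ := by
        gcongr
        · exact sum_inv_succ_le_one_add_log m
        · exact H.summable_η.sum_le_tsum _ fun i _ => H.η_nonneg i

lemma sum_integral_le_log [IsProbabilityMeasure μ] (H : TailControl μ h C η) (m : ℕ) :
    ∑ i ∈ Finset.range m, ∫ ω, h i ω ∂μ ≤ (1 + C) * (1 + Real.log m) + ∑' i, η i := by
  have := H.sum_setIntegral_le_log (s := Set.univ) MeasurableSet.univ one_pos (by simp) m
  simpa using this

/-- Logarithmic growth along sets of total mass `t`. -/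
lemma sum_setIntegral_le_log_mass [IsProbabilityMeasure μ] (H : TailControl μ h C η) {B : ℕ → Set Ω}
    (hB : ∀ i, MeasurableSet (B i)) {N : ℕ} {t : ℝ} (ht : 0 ≤ t)
    (hmass : ∑ i ∈ Finset.range N, μ.real (B i) ≤ t) :
    ∑ i ∈ Finset.range N, ∫ ω in B i, h i ω ∂μ
      ≤ (1 + C) * Real.log (t + 2) + 2 * (1 + C + ∑' i, η i) := by
  have hC := H.C_nonneg
  have hη := H.tsum_nonneg
  have h1 : t ≤ (⌈t⌉₊ + 1 : ℕ) := (Nat.le_ceil t).trans (by push_cast; linarith)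
  have h2 : ((⌈t⌉₊ + 1 : ℕ) : ℝ) ≤ t + 2 := by
    push_cast
    have := Nat.ceil_lt_add_one ht
    linarith
  have h3 := H.sum_setIntegral_le hB (m := ⌈t⌉₊ + 1) (by omega) (hmass.trans h1)
  have h4 := H.sum_integral_le_log (⌈t⌉₊ + 1)
  have h5 : Real.log ((⌈t⌉₊ + 1 : ℕ) : ℝ) ≤ Real.log (t + 2) :=
    Real.log_le_log (by positivity) h2
  nlinarith

end TailControl

/-! ### Random walks with positive drift, perturbed by a martingale and a slowly growing loss -/

/-- An adapted process with increments `drift + slope * noise i + err i * noise i - loss i`, where the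
`noise i` are centred and independent of the past, and `err i`, `loss i` are predictable and small. -/
structure PerturbedWalk [mΩ : MeasurableSpace Ω] (μ : Measure Ω) where
  ℱ : Filtration ℕ mΩ
  (noise err loss : ℕ → Ω → ℝ)
  (drift slope noiseVar C K ρ rate : ℝ)
  η : ℕ → ℝ
  drift_pos : 0 < drift
  ρ_pos : 0 < ρ
  K_nonneg : 0 ≤ K
  rate_nonneg : 0 ≤ rate
  measurable_noise : ∀ i, Measurable[ℱ (i + 1)] (noise i)
  measurable_err : ∀ i, Measurable[ℱ i] (err i)
  measurable_loss : ∀ i, Measurable[ℱ i] (loss i)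
  indep : ∀ i, Indep (MeasurableSpace.comap (noise i) inferInstance) (ℱ i) μ
  memLp_noise : ∀ i, MemLp (noise i) 2 μ
  integral_noise : ∀ i, ∫ ω, noise i ω ∂μ = 0
  integral_noise_sq : ∀ i, ∫ ω, noise i ω ^ 2 ∂μ = noiseVar
  lead_tail : ∀ i u, ∫ ω in {ω | u < |drift + slope * noise i ω|}, |drift + slope * noise i ω| ∂μ
    ≤ K * Real.exp (-(ρ * u))
  err_sq : TailControl μ (fun i ω => err i ω ^ 2) C η
  loss_control : TailControl μ loss C η
  loss_sum : ∀ ε, 0 < ε → ∃ M, ∀ m : ℕ, 1 ≤ m →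
    |∑ i ∈ Finset.range m, ∫ ω, loss i ω ∂μ - rate * Real.log m| ≤ ε * Real.log m + M

namespace PerturbedWalk

variable [mΩ : MeasurableSpace Ω] {μ : Measure Ω} (w : PerturbedWalk μ)

/-- The main part of the increment. -/
def lead (i : ℕ) (ω : Ω) : ℝ := w.drift + w.slope * w.noise i ω

/-- The increment of the walk. -/
def step (i : ℕ) (ω : Ω) : ℝ := w.lead i ω + w.err i ω * w.noise i ω - w.loss i ω

/-- The walk itself. -/
def walk (n : ℕ) (ω : Ω) : ℝ := ∑ i ∈ Finset.range n, w.step i ω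

/-- The event that the walk has not reached the level `b` at the times `1, …, i`. -/
def below (b : ℝ) (i : ℕ) : Set Ω := {ω | ∀ n, 1 ≤ n → n ≤ i → w.walk n ω < b}

/-- The event that the walk reaches `b` for the first time at time `i + 1`. -/
def crossing (b : ℝ) (i : ℕ) : Set Ω := w.below b i \ w.below b (i + 1)

/-- The second moment of the main part of the increment. -/
def leadSq : ℝ := w.drift ^ 2 + w.slope ^ 2 * w.noiseVar

lemma measurable_noise' (i : ℕ) : Measurable (w.noise i) :=
  (w.measurable_noise i).mono (w.ℱ.le _) le_rfl

lemma measurable_err' (i : ℕ) : Measurable (w.err i) :=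
  (w.measurable_err i).mono (w.ℱ.le _) le_rfl

lemma measurable_lead (i : ℕ) : Measurable (w.lead i) :=
  measurable_const.add (measurable_const.mul (w.measurable_noise' i))

lemma measurable_step (i : ℕ) : Measurable[w.ℱ (i + 1)] (w.step i) := by
  have h1 := w.measurable_noise i
  have h2 := (w.measurable_err i).mono (w.ℱ.mono (Nat.le_succ i)) le_rfl
  have h3 := (w.measurable_loss i).mono (w.ℱ.mono (Nat.le_succ i)) le_rfl
  exact ((measurable_const.add (measurable_const.mul h1)).add (h2.mul h1)).sub h3

lemma measurable_walk (n : ℕ) : Measurable[w.ℱ n] (w.walk n) := by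
  unfold walk
  refine Finset.measurable_sum _ fun i hi => ?_
  exact (w.measurable_step i).mono (w.ℱ.mono (Finset.mem_range.mp hi)) le_rfl

lemma measurableSet_below (b : ℝ) (i : ℕ) : MeasurableSet[w.ℱ i] (w.below b i) := by
  have : w.below b i = ⋂ n ∈ Finset.Icc 1 i, {ω | w.walk n ω < b} := by
    ext ω
    simp [below]
  rw [this]
  refine Finset.measurableSet_biInter _ fun n hn => ?_
  exact w.ℱ.mono (Finset.mem_Icc.mp hn).2 _ (w.measurable_walk n measurableSet_Iio)

lemma measurableSet_below' (b : ℝ) (i : ℕ) : MeasurableSet (w.below b i) :=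
  w.ℱ.le _ _ (w.measurableSet_below b i)

lemma measurableSet_crossing (b : ℝ) (i : ℕ) : MeasurableSet (w.crossing b i) :=
  (w.measurableSet_below' b i).diff (w.measurableSet_below' b (i + 1))

lemma below_antitone (b : ℝ) : Antitone (w.below b) :=
  fun _ _ hij _ hω n h1 h2 => hω n h1 (h2.trans hij)

lemma below_mono {b c : ℝ} (hbc : b ≤ c) (i : ℕ) : w.below b i ⊆ w.below c i :=
  fun _ hω n h1 h2 => (hω n h1 h2).trans_le hbc

lemma below_zero (b : ℝ) : w.below b 0 = Set.univ := by
  ext ω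
  simp only [below, Set.mem_ofPred_eq, Set.mem_univ, iff_true]
  intro n h1 h2
  omega

lemma walk_succ (n : ℕ) (ω : Ω) : w.walk (n + 1) ω = w.walk n ω + w.step n ω :=
  Finset.sum_range_succ _ _

lemma walk_lt_of_mem_below {b : ℝ} {i : ℕ} (hi : 1 ≤ i) {ω : Ω} (hω : ω ∈ w.below b i) :
    w.walk i ω < b := hω i hi le_rfl

lemma mem_below_succ {b : ℝ} {i : ℕ} {ω : Ω} :
    ω ∈ w.below b (i + 1) ↔ ω ∈ w.below b i ∧ w.walk (i + 1) ω < b := by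
  constructor
  · intro h
    exact ⟨w.below_antitone b (Nat.le_succ i) h, h _ (by omega) le_rfl⟩
  · rintro ⟨h1, h2⟩ n hn hni
    rcases Nat.lt_or_ge i n with h | h
    · obtain rfl : n = i + 1 := by omega
      exact h2
    · exact h1 n hn h

lemma le_walk_of_mem_crossing {b : ℝ} {i : ℕ} {ω : Ω} (hω : ω ∈ w.crossing b i) :
    b ≤ w.walk (i + 1) ω := by
  by_contra h
  exact hω.2 (w.mem_below_succ.2 ⟨hω.1, not_le.mp h⟩)

section Integrals

lemma indepFun_noise {i : ℕ} {g : Ω → ℝ} (hg : Measurable[w.ℱ i] g) :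
    IndepFun g (w.noise i) μ :=
  (indep_of_indep_of_le_right (w.indep i) hg.comap_le).symm

lemma integrable_noise_sq (i : ℕ) : Integrable (fun ω => w.noise i ω ^ 2) μ :=
  (w.memLp_noise i).integrable_sq

lemma memLp_err (i : ℕ) : MemLp (w.err i) 2 μ :=
  (memLp_two_iff_integrable_sq (w.measurable_err' i).aestronglyMeasurable).2
    (w.err_sq.integrable i)

lemma noiseVar_nonneg : 0 ≤ w.noiseVar := by
  rw [← w.integral_noise_sq 0]
  exact integral_nonneg fun ω => sq_nonneg _

lemma integrable_mul_comp_noise {i : ℕ} {g : Ω → ℝ} (hg : Measurable[w.ℱ i] g)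
    (hgi : Integrable g μ) {f : ℝ → ℝ} (hf : Measurable f)
    (hfi : Integrable (fun ω => f (w.noise i ω)) μ) :
    Integrable (fun ω => g ω * f (w.noise i ω)) μ :=
  ((w.indepFun_noise hg).comp measurable_id hf).integrable_mul hgi hfi

/-- Independence of the new noise from the past. Since {τ_b > i} belongs to `ℱ i`, every conditional
moment of an increment used below comes from this factorization. -/
lemma setIntegral_mul_comp_noise {i : ℕ} {s : Set Ω} (hs : MeasurableSet[w.ℱ i] s) {g : Ω → ℝ}
    (hg : Measurable[w.ℱ i] g) {f : ℝ → ℝ} (hf : Measurable f) :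
    ∫ ω in s, g ω * f (w.noise i ω) ∂μ = (∫ ω in s, g ω ∂μ) * ∫ ω, f (w.noise i ω) ∂μ := by
  have hs' := w.ℱ.le _ _ hs
  have hg' : Measurable[w.ℱ i] (s.indicator g) := Measurable.indicator hg hs
  rw [← integral_indicator hs', ← integral_indicator hs']
  have h1 : s.indicator (fun ω => g ω * f (w.noise i ω))
      = fun ω => s.indicator g ω * f (w.noise i ω) := by
    ext ω
    by_cases h : ω ∈ s <;> simp [h]
  rw [h1]
  exact ((w.indepFun_noise hg').comp measurable_id hf).integral_fun_mul_eq_mul_integral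
    (hg'.mono (w.ℱ.le _) le_rfl).aestronglyMeasurable
    (hf.comp (w.measurable_noise' i)).aestronglyMeasurable

lemma setIntegral_comp_noise {i : ℕ} {s : Set Ω} (hs : MeasurableSet[w.ℱ i] s)
    {f : ℝ → ℝ} (hf : Measurable f) :
    ∫ ω in s, f (w.noise i ω) ∂μ = μ.real s * ∫ ω, f (w.noise i ω) ∂μ := by
  have := w.setIntegral_mul_comp_noise hs (g := fun _ => 1) measurable_const hf
  simpa using this

lemma integrable_err_mul_noise_sq (i : ℕ) :
    Integrable (fun ω => (w.err i ω * w.noise i ω) ^ 2) μ := by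
  simp_rw [mul_pow]
  exact w.integrable_mul_comp_noise (g := fun ω => w.err i ω ^ 2) (f := fun x => x ^ 2)
    ((w.measurable_err i).pow_const 2) (w.err_sq.integrable i) (measurable_id.pow_const 2)
    (w.integrable_noise_sq i)

lemma setIntegral_err_mul_noise_sq {i : ℕ} {s : Set Ω} (hs : MeasurableSet[w.ℱ i] s) :
    ∫ ω in s, (w.err i ω * w.noise i ω) ^ 2 ∂μ = w.noiseVar * ∫ ω in s, w.err i ω ^ 2 ∂μ := by
  have h := w.setIntegral_mul_comp_noise hs (g := fun ω => w.err i ω ^ 2) (f := fun x => x ^ 2)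
    ((w.measurable_err i).pow_const 2) (measurable_id.pow_const 2)
  simp_rw [mul_pow]
  rw [h, w.integral_noise_sq, mul_comm]

lemma setIntegral_lead_tail {i : ℕ} {s : Set Ω} (hs : MeasurableSet[w.ℱ i] s) (u : ℝ) :
    ∫ ω in s, {ω | u < |w.lead i ω|}.indicator (fun ω => |w.lead i ω|) ω ∂μ
      ≤ μ.real s * (w.K * Real.exp (-(w.ρ * u))) := by
  set T : Set ℝ := {x | u < |w.drift + w.slope * x|} with hT
  have hTm : MeasurableSet T := by
    rw [hT]
    exact measurableSet_lt measurable_const (by fun_prop)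
  have h := w.setIntegral_comp_noise hs
    (f := T.indicator fun x => |w.drift + w.slope * x|)
    (Measurable.indicator (by fun_prop) hTm)
  have h1 : ∀ ω, {ω | u < |w.lead i ω|}.indicator (fun ω => |w.lead i ω|) ω
      = T.indicator (fun x => |w.drift + w.slope * x|) (w.noise i ω) := by
    intro ω
    by_cases hω : u < |w.drift + w.slope * w.noise i ω| <;> simp [lead, hT, hω]
  have h2 : ∫ ω, T.indicator (fun x => |w.drift + w.slope * x|) (w.noise i ω) ∂μ
      ≤ w.K * Real.exp (-(w.ρ * u)) := by
    refine le_trans (le_of_eq ?_) (w.lead_tail i u)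
    refine (integral_congr_ae (ae_of_all _ fun ω => (h1 ω).symm)).trans ?_
    exact integral_indicator (measurableSet_lt measurable_const (w.measurable_lead i).abs)
  simp_rw [h1]
  rw [h]
  gcongr

variable [IsProbabilityMeasure μ]

lemma integrable_noise (i : ℕ) : Integrable (w.noise i) μ :=
  (w.memLp_noise i).integrable (by norm_num)

lemma integrable_err (i : ℕ) : Integrable (w.err i) μ :=
  (w.memLp_err i).integrable (by norm_num)

lemma memLp_lead (i : ℕ) : MemLp (w.lead i) 2 μ :=
  (memLp_const w.drift).add ((w.memLp_noise i).const_mul w.slope)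

lemma integrable_lead (i : ℕ) : Integrable (w.lead i) μ :=
  (w.memLp_lead i).integrable (by norm_num)

lemma integrable_err_mul_noise (i : ℕ) : Integrable (fun ω => w.err i ω * w.noise i ω) μ :=
  w.integrable_mul_comp_noise (w.measurable_err i) (w.integrable_err i) measurable_id
    (w.integrable_noise i)

lemma integrable_step (i : ℕ) : Integrable (w.step i) μ :=
  ((w.integrable_lead i).add (w.integrable_err_mul_noise i)).sub (w.loss_control.integrable i)

lemma setIntegral_lead_sq {i : ℕ} {s : Set Ω} (hs : MeasurableSet[w.ℱ i] s) :
    ∫ ω in s, w.lead i ω ^ 2 ∂μ = μ.real s * w.leadSq := by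
  have h := w.setIntegral_comp_noise hs (f := fun x => (w.drift + w.slope * x) ^ 2) (by fun_prop)
  have h2 : ∫ ω, (w.drift + w.slope * w.noise i ω) ^ 2 ∂μ = w.leadSq := by
    have h3 : ∀ ω, (w.drift + w.slope * w.noise i ω) ^ 2
        = w.drift ^ 2 + (2 * w.drift * w.slope) * w.noise i ω + w.slope ^ 2 * w.noise i ω ^ 2 :=
      fun ω => by ring
    simp_rw [h3]
    have h4 : Integrable (fun ω => w.drift ^ 2 + (2 * w.drift * w.slope) * w.noise i ω) μ :=
      (integrable_const _).add ((w.integrable_noise i).const_mul _)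
    rw [integral_add h4 ((w.integrable_noise_sq i).const_mul _), integral_add (integrable_const _)
      ((w.integrable_noise i).const_mul _), integral_const_mul, integral_const_mul,
      w.integral_noise, w.integral_noise_sq]
    simp [leadSq]
  rw [h2] at h
  exact h

/-- Wald's identity for one increment. -/
lemma setIntegral_step {i : ℕ} {s : Set Ω} (hs : MeasurableSet[w.ℱ i] s) :
    ∫ ω in s, w.step i ω ∂μ = w.drift * μ.real s - ∫ ω in s, w.loss i ω ∂μ := by
  have h1 := w.setIntegral_comp_noise hs (f := fun x => x) measurable_id
  have h2 := w.setIntegral_mul_comp_noise hs (w.measurable_err i) (f := fun x => x) measurable_id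
  rw [w.integral_noise, mul_zero] at h1 h2
  have e1 : ∫ ω in s, w.step i ω ∂μ = ∫ ω in s, (w.lead i ω + w.err i ω * w.noise i ω) ∂μ
      - ∫ ω in s, w.loss i ω ∂μ :=
    integral_sub ((w.integrable_lead i).add (w.integrable_err_mul_noise i)).integrableOn
      (w.loss_control.integrable i).integrableOn
  have e2 : ∫ ω in s, (w.lead i ω + w.err i ω * w.noise i ω) ∂μ = ∫ ω in s, w.lead i ω ∂μ + 0 := by
    rw [← h2]
    exact integral_add (w.integrable_lead i).integrableOn
      (w.integrable_err_mul_noise i).integrableOn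
  have e3 : ∫ ω in s, w.lead i ω ∂μ = ∫ ω in s, w.drift ∂μ + ∫ ω in s, w.slope * w.noise i ω ∂μ :=
    integral_add (integrable_const _) ((w.integrable_noise i).const_mul _).integrableOn
  rw [e1, e2, e3, integral_const_mul, h1]
  simp [mul_comm]

end Integrals

end PerturbedWalk

/-! ### The stopped walk, optional stopping, and a linear bound for the expected crossing time. -/

namespace PerturbedWalk

variable [mΩ : MeasurableSpace Ω] {μ : Measure Ω} (w : PerturbedWalk μ)

/-- The walk stopped at the level `b`, or at time `N`. -/
def stopped (b : ℝ) (N : ℕ) (ω : Ω) : ℝ :=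
  ∑ i ∈ Finset.range N, (w.below b i).indicator (w.step i) ω

/-- The positive part of the increment that crosses `b`, if this happens up to time `N`. -/
def jump (b : ℝ) (N : ℕ) (ω : Ω) : ℝ :=
  ∑ i ∈ Finset.range N, (w.crossing b i).indicator (fun ω => max (w.step i ω) 0) ω

/-- The expected number of steps before the level `b` is reached, truncated at `N`. -/
def mass (b : ℝ) (N : ℕ) : ℝ := ∑ i ∈ Finset.range N, μ.real (w.below b i)

/-- The expected loss accumulated before the level `b` is reached, truncated at `N`. -/
def lossMean (b : ℝ) (N : ℕ) : ℝ := ∑ i ∈ Finset.range N, ∫ ω in w.below b i, w.loss i ω ∂μ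

/-- The expected squared error accumulated before the level `b` is reached, truncated at `N`. -/
def errMean (b : ℝ) (N : ℕ) : ℝ := ∑ i ∈ Finset.range N, ∫ ω in w.below b i, w.err i ω ^ 2 ∂μ

/-- The mean of `jump`. -/
def jumpMean (b : ℝ) (N : ℕ) : ℝ :=
  ∑ i ∈ Finset.range N, ∫ ω in w.crossing b i, max (w.step i ω) 0 ∂μ

lemma jump_nonneg (b : ℝ) (N : ℕ) (ω : Ω) : 0 ≤ w.jump b N ω :=
  Finset.sum_nonneg fun _ _ => Set.indicator_nonneg (fun _ _ => le_max_right _ _) _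

lemma stopped_eq_walk {b : ℝ} {N : ℕ} {ω : Ω} (hω : ω ∈ w.below b N) :
    w.stopped b N ω = w.walk N ω := by
  refine Finset.sum_congr rfl fun i hi => ?_
  exact Set.indicator_of_mem (w.below_antitone b (Finset.mem_range.mp hi).le hω) _

lemma le_stopped {b : ℝ} {N : ℕ} {ω : Ω} (hω : ω ∉ w.below b N) : b ≤ w.stopped b N ω := by
  induction N with
  | zero => simp [below_zero] at hω
  | succ N ih =>
    by_cases h : ω ∈ w.below b N
    · have h1 := w.le_walk_of_mem_crossing (b := b) (i := N) ⟨h, hω⟩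
      have h2 := w.stopped_eq_walk h
      simp only [stopped] at h2 ⊢
      rw [Finset.sum_range_succ, h2, Set.indicator_of_mem h, ← w.walk_succ]
      exact h1
    · have := ih h
      simp only [stopped] at this ⊢
      rw [Finset.sum_range_succ, Set.indicator_of_notMem h, add_zero]
      exact this

/-- Just before crossing, the walk is still below b, so only the crossing increment can carry it
beyond. The maximum with 0 covers a crossing at the first step, where the walk starts at 0 and b may
be negative. -/
lemma stopped_le (b : ℝ) (N : ℕ) (ω : Ω) : w.stopped b N ω ≤ max b 0 + w.jump b N ω := by
  induction N with
  | zero => simp [stopped, jump]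
  | succ N ih =>
    have hj : w.jump b N ω ≤ w.jump b (N + 1) ω := by
      simp only [jump]
      rw [Finset.sum_range_succ]
      have : 0 ≤ (w.crossing b N).indicator (fun ω => max (w.step N ω) 0) ω :=
        Set.indicator_nonneg (fun _ _ => le_max_right _ _) _
      linarith
    by_cases h' : ω ∈ w.below b (N + 1)
    · rw [w.stopped_eq_walk h']
      have h1 := w.walk_lt_of_mem_below (by omega) h'
      have h2 := w.jump_nonneg b (N + 1) ω
      have h3 := le_max_left b 0
      linarith
    · by_cases h : ω ∈ w.below b N
      · have h0 : w.walk N ω ≤ max b 0 := by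
          rcases Nat.eq_zero_or_pos N with rfl | hN
          · simp [walk]
          · exact (w.walk_lt_of_mem_below hN h).le.trans (le_max_left _ _)
        have h1 : w.stopped b (N + 1) ω = w.walk N ω + w.step N ω := by
          have h2 := w.stopped_eq_walk h
          simp only [stopped] at h2 ⊢
          rw [Finset.sum_range_succ, h2, Set.indicator_of_mem h]
        have h2 : w.jump b (N + 1) ω = w.jump b N ω + max (w.step N ω) 0 := by
          simp only [jump]
          have hc : ω ∈ w.crossing b N := ⟨h, h'⟩
          rw [Finset.sum_range_succ, Set.indicator_of_mem hc]
        have h3 := w.jump_nonneg b N ω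
        have h4 := le_max_left (w.step N ω) 0
        linarith
      · have h1 : w.stopped b (N + 1) ω = w.stopped b N ω := by
          simp only [stopped]
          rw [Finset.sum_range_succ, Set.indicator_of_notMem h, add_zero]
        linarith

lemma stopped_sub_stopped_le {b b' : ℝ} (hb : b' ≤ b) (N : ℕ) (ω : Ω) :
    w.stopped b N ω - w.stopped b' N ω ≤ max b 0 - b' + w.jump b N ω := by
  by_cases h : ω ∈ w.below b' N
  · rw [w.stopped_eq_walk h, w.stopped_eq_walk (w.below_mono hb N h)]
    have := w.jump_nonneg b N ω
    have := le_max_left b 0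
    linarith
  · have h1 := w.le_stopped h
    have h2 := w.stopped_le b N ω
    linarith

section Integrals

lemma mass_nonneg (b : ℝ) (N : ℕ) : 0 ≤ w.mass b N :=
  Finset.sum_nonneg fun _ _ => measureReal_nonneg

lemma lossMean_nonneg (b : ℝ) (N : ℕ) : 0 ≤ w.lossMean b N :=
  Finset.sum_nonneg fun _ _ => w.loss_control.setIntegral_nonneg _ _

lemma step_le (i : ℕ) (ω : Ω) : w.step i ω ≤ w.lead i ω + w.err i ω * w.noise i ω := by
  have := w.loss_control.nonneg i ω
  unfold step
  linarith

lemma leadSq_pos : 0 < w.leadSq := by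
  have := w.noiseVar_nonneg
  have := w.drift_pos
  unfold leadSq
  positivity

lemma memLp_err_mul_noise (i : ℕ) : MemLp (fun ω => w.err i ω * w.noise i ω) 2 μ :=
  (memLp_two_iff_integrable_sq
    ((w.measurable_err' i).mul (w.measurable_noise' i)).aestronglyMeasurable).2
    (w.integrable_err_mul_noise_sq i)

lemma max_step_le (i : ℕ) (ω : Ω) :
    max (w.step i ω) 0 ≤ |w.lead i ω| + |w.err i ω * w.noise i ω| := by
  refine max_le ((w.step_le i ω).trans ?_) (by positivity)
  gcongr <;> exact le_abs_self _

variable [IsProbabilityMeasure μ]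

lemma integrable_stopped (b : ℝ) (N : ℕ) : Integrable (w.stopped b N) μ :=
  integrable_finsetSum _ fun i _ => (w.integrable_step i).indicator (w.measurableSet_below' b i)

lemma integrable_jump (b : ℝ) (N : ℕ) : Integrable (w.jump b N) μ :=
  integrable_finsetSum _ fun i _ =>
    ((w.integrable_step i).pos_part).indicator (w.measurableSet_crossing b i)

lemma integral_stopped (b : ℝ) (N : ℕ) :
    ∫ ω, w.stopped b N ω ∂μ = w.drift * w.mass b N - w.lossMean b N := by
  unfold stopped mass lossMean
  rw [integral_finsetSum _ fun i _ =>
    (w.integrable_step i).indicator (w.measurableSet_below' b i), Finset.mul_sum,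
    ← Finset.sum_sub_distrib]
  refine Finset.sum_congr rfl fun i _ => ?_
  rw [integral_indicator (w.measurableSet_below' b i)]
  exact w.setIntegral_step (w.measurableSet_below b i)

lemma integral_jump (b : ℝ) (N : ℕ) : ∫ ω, w.jump b N ω ∂μ = w.jumpMean b N := by
  unfold jump jumpMean
  rw [integral_finsetSum _ fun i _ =>
    ((w.integrable_step i).pos_part).indicator (w.measurableSet_crossing b i)]
  exact Finset.sum_congr rfl fun i _ => integral_indicator (w.measurableSet_crossing b i)

lemma drift_mul_mass_le (b : ℝ) (N : ℕ) :
    w.drift * w.mass b N ≤ max b 0 + w.jumpMean b N + w.lossMean b N := by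
  have h := integral_mono (w.integrable_stopped b N)
    ((integrable_const (max b 0)).add (w.integrable_jump b N)) (w.stopped_le b N)
  have h2 : ∫ ω, ((fun _ : Ω => max b 0) + w.jump b N) ω ∂μ = max b 0 + w.jumpMean b N := by
    simp only [Pi.add_apply]
    rw [integral_add (integrable_const _) (w.integrable_jump b N), w.integral_jump]
    simp
  rw [h2, w.integral_stopped] at h
  linarith

/-- Bounds the expected time spent between two levels. The bound contains the mean crossing
increment itself, which makes the later overshoot estimate a self-referential inequality. -/
lemma drift_mul_mass_sub_le {b b' : ℝ} (hb : b' ≤ b) (N : ℕ) :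
    w.drift * (w.mass b N - w.mass b' N) ≤ max b 0 - b' + w.jumpMean b N + w.lossMean b N := by
  have h := integral_mono ((w.integrable_stopped b N).sub (w.integrable_stopped b' N))
    ((integrable_const (max b 0 - b')).add (w.integrable_jump b N))
    (w.stopped_sub_stopped_le hb N)
  have h2 : ∫ ω, ((fun _ : Ω => max b 0 - b') + w.jump b N) ω ∂μ
      = max b 0 - b' + w.jumpMean b N := by
    simp only [Pi.add_apply]
    rw [integral_add (integrable_const _) (w.integrable_jump b N), w.integral_jump]
    simp
  have h3 : ∫ ω, (w.stopped b N - w.stopped b' N) ω ∂μ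
      = ∫ ω, w.stopped b N ω ∂μ - ∫ ω, w.stopped b' N ω ∂μ :=
    integral_sub (w.integrable_stopped b N) (w.integrable_stopped b' N)
  rw [h2, h3, w.integral_stopped, w.integral_stopped] at h
  have := w.lossMean_nonneg b' N
  linarith

/-- The level is crossed for the first time at most once; the probabilities telescope. -/
lemma sum_crossing_le_one (b : ℝ) (N : ℕ) :
    ∑ i ∈ Finset.range N, μ.real (w.crossing b i) ≤ 1 := by
  have h : ∀ i, μ.real (w.crossing b i) = μ.real (w.below b i) - μ.real (w.below b (i + 1)) :=
    fun i => measureReal_sdiff (w.below_antitone b (Nat.le_succ i)) (w.measurableSet_below' b _)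
  simp_rw [h]
  rw [Finset.sum_range_sub', below_zero]
  simp [measureReal_nonneg]

/-- Integrates |f| ≤ r + f²/r. Two sets appear because a crossing event is not in the past: the
linear term keeps the crossing event, whose probabilities sum to at most 1, while the quadratic term
is enlarged to an event of the past, where the second moment factors. -/
lemma setIntegral_abs_le {f : Ω → ℝ} (hf : MemLp f 2 μ) {s t : Set Ω} (hst : s ⊆ t) {r : ℝ}
    (hr : 0 < r) : ∫ ω in s, |f ω| ∂μ ≤ r * μ.real s + r⁻¹ * ∫ ω in t, f ω ^ 2 ∂μ := by
  have h0 := hf.integrable_sq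
  have h1 : ∫ ω in s, |f ω| ∂μ ≤ ∫ ω in s, (r + r⁻¹ * f ω ^ 2) ∂μ := by
    refine integral_mono (hf.integrable (by norm_num)).abs.integrableOn
      ((integrable_const r).add (h0.const_mul _).integrableOn) fun ω => ?_
    have h2 : 0 ≤ r⁻¹ * (|f ω| - r) ^ 2 := by positivity
    have h3 : r⁻¹ * (|f ω| - r) ^ 2 = r⁻¹ * f ω ^ 2 - 2 * |f ω| + r := by
      field_simp
      rw [sub_sq, sq_abs]
      ring
    have := abs_nonneg (f ω)
    simp only
    linarith
  rw [integral_add (integrable_const r) (h0.const_mul _).integrableOn, integral_const_mul] at h1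
  have h2 : ∫ ω in s, f ω ^ 2 ∂μ ≤ ∫ ω in t, f ω ^ 2 ∂μ :=
    setIntegral_mono_set h0.integrableOn (ae_of_all _ fun ω => sq_nonneg _) hst.eventuallyLE
  have h3 : r⁻¹ * ∫ ω in s, f ω ^ 2 ∂μ ≤ r⁻¹ * ∫ ω in t, f ω ^ 2 ∂μ := by gcongr
  simp only [integral_const, measureReal_restrict_apply_univ, smul_eq_mul] at h1
  linarith

/-- A crude bound, linear in the expected time but with a coefficient `r⁻¹ * leadSq` that can be
made smaller than the drift; this suffices for E τ_b = O(1 + b⁺). -/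
lemma jumpMean_le_of_pos (b : ℝ) (N : ℕ) {r : ℝ} (hr : 0 < r) :
    w.jumpMean b N ≤ r + r⁻¹ * (w.leadSq * w.mass b N) + 1 + w.noiseVar * w.errMean b N := by
  have hsub : ∀ i, w.crossing b i ⊆ w.below b i := fun i => Set.sdiff_subset
  have h1 : ∀ i, ∫ ω in w.crossing b i, max (w.step i ω) 0 ∂μ
      ≤ (r * μ.real (w.crossing b i) + r⁻¹ * (μ.real (w.below b i) * w.leadSq))
        + (1 * μ.real (w.crossing b i)
          + 1⁻¹ * (w.noiseVar * ∫ ω in w.below b i, w.err i ω ^ 2 ∂μ)) := by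
    intro i
    rw [← w.setIntegral_lead_sq (w.measurableSet_below b i),
      ← w.setIntegral_err_mul_noise_sq (w.measurableSet_below b i)]
    refine le_trans ?_ (add_le_add (setIntegral_abs_le (w.memLp_lead i) (hsub i) hr)
      (setIntegral_abs_le (w.memLp_err_mul_noise i) (hsub i) one_pos))
    rw [← integral_add (w.integrable_lead i).abs.integrableOn
      (w.integrable_err_mul_noise i).abs.integrableOn]
    exact integral_mono (w.integrable_step i).pos_part.integrableOn
      ((w.integrable_lead i).abs.add (w.integrable_err_mul_noise i).abs).integrableOn
      (w.max_step_le i)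
  have h2 : w.jumpMean b N ≤ _ := Finset.sum_le_sum fun i _ => h1 i
  simp only [Finset.sum_add_distrib, ← Finset.mul_sum, ← Finset.sum_mul] at h2
  have h3 := w.sum_crossing_le_one b N
  have h4 : r * ∑ i ∈ Finset.range N, μ.real (w.crossing b i) ≤ r := by nlinarith
  unfold mass errMean
  rw [mul_comm w.leadSq]
  linarith

lemma lossMean_le (b : ℝ) (N : ℕ) :
    w.lossMean b N ≤ (1 + w.C) * Real.log (w.mass b N + 2) + 2 * (1 + w.C + ∑' i, w.η i) :=
  w.loss_control.sum_setIntegral_le_log_mass (w.measurableSet_below' b) (w.mass_nonneg b N) le_rfl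

lemma errMean_le (b : ℝ) (N : ℕ) :
    w.errMean b N ≤ (1 + w.C) * Real.log (w.mass b N + 2) + 2 * (1 + w.C + ∑' i, w.η i) :=
  w.err_sq.sum_setIntegral_le_log_mass (w.measurableSet_below' b) (w.mass_nonneg b N) le_rfl

/-- The expected crossing time is at most linear in the level. -/
lemma exists_mass_le : ∃ M, 0 < M ∧ ∀ b N, w.mass b N ≤ M * (1 + max b 0) := by
  have hd := w.drift_pos
  have hv := w.noiseVar_nonneg
  have hC := w.err_sq.C_nonneg
  have hη := w.err_sq.tsum_nonneg
  set D := (w.noiseVar + 1) * (1 + w.C) with hD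
  set E := (w.noiseVar + 1) * (2 * (1 + w.C + ∑' i, w.η i)) with hE
  have hDpos : 0 < D := by positivity
  have hEpos : 0 < E := by positivity
  -- The drift pays for everything: half of it absorbs the crossing increment (choice of r), a
  -- quarter absorbs the logarithmic terms (D·δ = drift/4), and a quarter is left over.
  set δ := w.drift / (4 * D) with hδ
  have hδpos : 0 < δ := by positivity
  set r := 2 * w.leadSq / w.drift with hr
  have hrpos : 0 < r := by
    have := w.leadSq_pos
    positivity
  set A := r + 1 + E + D * (2 * δ + |Real.log δ|) with hA
  have hApos : 0 < A := by positivity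
  refine ⟨4 / w.drift * (1 + A), by positivity, fun b N => ?_⟩
  have hm := w.mass_nonneg b N
  set t := w.mass b N with ht
  have h1 := w.drift_mul_mass_le b N
  have h2 := w.jumpMean_le_of_pos b N hrpos
  have h3 := w.lossMean_le b N
  have h4 := w.errMean_le b N
  have h5 : Real.log (t + 2) ≤ δ * t + (2 * δ + |Real.log δ|) := by
    have h6 := Real.log_le_sub_one_of_pos (x := δ * (t + 2)) (by positivity)
    rw [Real.log_mul hδpos.ne' (by positivity)] at h6
    have := neg_abs_le (Real.log δ)
    linarith
  have h6 : r⁻¹ * (w.leadSq * t) = w.drift / 2 * t := by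
    have := w.leadSq_pos
    rw [hr]
    field_simp
  have h7 : w.noiseVar * w.errMean b N + w.lossMean b N ≤ D * Real.log (t + 2) + E := by
    have := mul_le_mul_of_nonneg_left h4 hv
    rw [hD, hE]
    linarith
  have h8 : D * Real.log (t + 2) ≤ w.drift / 4 * t + D * (2 * δ + |Real.log δ|) := by
    have := mul_le_mul_of_nonneg_left h5 hDpos.le
    have h9 : D * δ = w.drift / 4 := by
      rw [hδ]
      field_simp
    calc _ ≤ _ := this
      _ = D * δ * t + D * (2 * δ + |Real.log δ|) := by ring
      _ = _ := by rw [h9]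
  have h10 : w.drift / 4 * t ≤ max b 0 + A := by
    rw [hA]
    linarith
  have hb : 0 ≤ max b 0 := le_max_right _ _
  calc t = 4 / w.drift * (w.drift / 4 * t) := by field_simp
    _ ≤ 4 / w.drift * (max b 0 + A) := by gcongr
    _ ≤ 4 / w.drift * ((1 + A) * (1 + max b 0)) := by
      gcongr
      nlinarith
    _ = _ := by ring

lemma exists_log_mass_le : ∃ M, 0 < M ∧ ∀ b, 1 ≤ b → ∀ N,
    w.mass b N ≤ M * b ∧ Real.log (w.mass b N + 2) ≤ Real.log b + M := by
  obtain ⟨M, hM, h⟩ := w.exists_mass_le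
  refine ⟨2 * M + 2, by positivity, fun b hb N => ?_⟩
  have h1 := h b N
  rw [max_eq_left (by linarith)] at h1
  have h2 := w.mass_nonneg b N
  have h3 : w.mass b N + 2 ≤ (2 * M + 2) * b := by nlinarith
  refine ⟨by nlinarith, ?_⟩
  calc Real.log (w.mass b N + 2) ≤ Real.log ((2 * M + 2) * b) :=
        Real.log_le_log (by positivity) h3
    _ = Real.log (2 * M + 2) + Real.log b := Real.log_mul (by positivity) (by positivity)
    _ ≤ _ := by
      have := Real.log_le_sub_one_of_pos (x := 2 * M + 2) (by positivity)
      linarith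

end Integrals

end PerturbedWalk

/-! ### The overshoot, and the upper bound for the expected crossing time. -/

namespace PerturbedWalk

variable [mΩ : MeasurableSpace Ω] {μ : Measure Ω} (w : PerturbedWalk μ)

/-- A crossing increment is either large, or starts above a slightly lower level. -/
lemma max_step_le_of_mem_crossing {b u : ℝ} (hb : 2 * u < b) {i : ℕ} {ω : Ω}
    (hω : ω ∈ w.crossing b i) :
    max (w.step i ω) 0 ≤ (w.below (b - 2 * u) i)ᶜ.indicator (fun ω => |w.lead i ω|) ω
      + {ω | u < |w.lead i ω|}.indicator (fun ω => |w.lead i ω|) ω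
      + 2 * |w.err i ω * w.noise i ω| := by
  have h1 : 0 ≤ (w.below (b - 2 * u) i)ᶜ.indicator (fun ω => |w.lead i ω|) ω :=
    Set.indicator_nonneg (fun _ _ => abs_nonneg _) _
  have h2 : 0 ≤ {ω | u < |w.lead i ω|}.indicator (fun ω => |w.lead i ω|) ω :=
    Set.indicator_nonneg (fun _ _ => abs_nonneg _) _
  have h3 := w.max_step_le i ω
  have h4 := abs_nonneg (w.err i ω * w.noise i ω)
  by_cases hA : ω ∈ w.below (b - 2 * u) i
  · by_cases hB : u < |w.lead i ω|
    · have h5 : {ω | u < |w.lead i ω|}.indicator (fun ω => |w.lead i ω|) ω = |w.lead i ω| :=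
        Set.indicator_of_mem (s := {ω | u < |w.lead i ω|}) hB _
      linarith
    -- Here the increment exceeds 2u although its main part is at most u, so the error term exceeds
    -- u, and twice the error term dominates the increment.
    · have h6 : w.walk i ω < b - 2 * u := by
        rcases Nat.eq_zero_or_pos i with rfl | hi
        · simpa [walk] using hb
        · exact w.walk_lt_of_mem_below hi hA
      have h7 := w.le_walk_of_mem_crossing hω
      rw [w.walk_succ] at h7
      have h8 := w.step_le i ω
      have h9 := le_abs_self (w.lead i ω)
      have h10 := le_abs_self (w.err i ω * w.noise i ω)
      refine max_le ?_ (by positivity)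
      linarith [not_lt.mp hB]
  · have h5 : (w.below (b - 2 * u) i)ᶜ.indicator (fun ω => |w.lead i ω|) ω = |w.lead i ω| :=
      Set.indicator_of_mem (s := (w.below (b - 2 * u) i)ᶜ) hA _
    linarith

variable [IsProbabilityMeasure μ]

/-- Compared with `jumpMean_le_of_pos`, the second moment is charged only for the time between the
levels b - 2u and b, rather than for the whole crossing time; the price is the exponential tail
term. -/
lemma jumpMean_le {b u : ℝ} (hu : 0 ≤ u) (hb : 2 * u < b) (N : ℕ) {r : ℝ} (hr : 0 < r) :
    w.jumpMean b N ≤ 3 * r + r⁻¹ * (w.leadSq * (w.mass b N - w.mass (b - 2 * u) N))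
      + w.K * Real.exp (-(w.ρ * u)) * w.mass b N + 2 * r⁻¹ * (w.noiseVar * w.errMean b N) := by
  set b' := b - 2 * u with hb'
  have hle : b' ≤ b := by linarith
  have h1 : ∀ i, ∫ ω in w.crossing b i, max (w.step i ω) 0 ∂μ
      ≤ (r * μ.real (w.crossing b i)
          + r⁻¹ * ((μ.real (w.below b i) - μ.real (w.below b' i)) * w.leadSq))
        + μ.real (w.below b i) * (w.K * Real.exp (-(w.ρ * u)))
        + 2 * (r * μ.real (w.crossing b i)
          + r⁻¹ * (w.noiseVar * ∫ ω in w.below b i, w.err i ω ^ 2 ∂μ)) := by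
    intro i
    have hcr := w.measurableSet_crossing b i
    have hB' := w.measurableSet_below' b' i
    have hsub : w.crossing b i ⊆ w.below b i := Set.sdiff_subset
    have i0 := (w.integrable_lead i).abs
    have hT : MeasurableSet {ω | u < |w.lead i ω|} :=
      measurableSet_lt measurable_const (w.measurable_lead i).abs
    have i1 := i0.indicator hB'.compl
    have i2 := i0.indicator hT
    have i3 := ((w.integrable_err_mul_noise i).abs).const_mul 2
    have e0 : ∫ ω in w.crossing b i, max (w.step i ω) 0 ∂μ
        ≤ ∫ ω in w.crossing b i, ((w.below b' i)ᶜ.indicator (fun ω => |w.lead i ω|) ω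
          + {ω | u < |w.lead i ω|}.indicator (fun ω => |w.lead i ω|) ω
          + 2 * |w.err i ω * w.noise i ω|) ∂μ :=
      setIntegral_mono_on (w.integrable_step i).pos_part.integrableOn
        ((i1.add i2).add i3).integrableOn hcr
        fun ω hω => w.max_step_le_of_mem_crossing hb hω
    have i12 : Integrable (fun ω => (w.below b' i)ᶜ.indicator (fun ω => |w.lead i ω|) ω
          + {ω | u < |w.lead i ω|}.indicator (fun ω => |w.lead i ω|) ω) μ := i1.add i2
    rw [integral_add i12.integrableOn i3.integrableOn,
      integral_add i1.integrableOn i2.integrableOn, integral_const_mul] at e0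
    have e1 : ∫ ω in w.crossing b i, (w.below b' i)ᶜ.indicator (fun ω => |w.lead i ω|) ω ∂μ
        ≤ r * μ.real (w.crossing b i)
          + r⁻¹ * ((μ.real (w.below b i) - μ.real (w.below b' i)) * w.leadSq) := by
      rw [setIntegral_indicator hB'.compl]
      have hm : MeasurableSet[w.ℱ i] (w.below b i \ w.below b' i) :=
        (w.measurableSet_below b i).diff (w.measurableSet_below b' i)
      rw [← measureReal_sdiff (w.below_mono hle i) hB', ← w.setIntegral_lead_sq hm]
      refine (setIntegral_abs_le (w.memLp_lead i) (t := w.below b i \ w.below b' i)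
        (fun ω hω => ⟨hsub hω.1, hω.2⟩) hr).trans ?_
      gcongr
      · exact measure_ne_top _ _
      · exact Set.inter_subset_left
    have e2 : ∫ ω in w.crossing b i, {ω | u < |w.lead i ω|}.indicator (fun ω => |w.lead i ω|) ω ∂μ
        ≤ μ.real (w.below b i) * (w.K * Real.exp (-(w.ρ * u))) := by
      refine le_trans ?_ (w.setIntegral_lead_tail (w.measurableSet_below b i) u)
      exact setIntegral_mono_set i2.integrableOn
        (ae_of_all _ fun ω => Set.indicator_nonneg (fun _ _ => abs_nonneg _) _)
        hsub.eventuallyLE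
    have e3 : ∫ ω in w.crossing b i, |w.err i ω * w.noise i ω| ∂μ
        ≤ r * μ.real (w.crossing b i)
          + r⁻¹ * (w.noiseVar * ∫ ω in w.below b i, w.err i ω ^ 2 ∂μ) := by
      rw [← w.setIntegral_err_mul_noise_sq (w.measurableSet_below b i)]
      exact setIntegral_abs_le (w.memLp_err_mul_noise i) hsub hr
    linarith
  have h2 : w.jumpMean b N ≤ _ := Finset.sum_le_sum fun i _ => h1 i
  simp only [Finset.sum_add_distrib, ← Finset.mul_sum, ← Finset.sum_mul,
    Finset.sum_sub_distrib] at h2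
  have h3 := w.sum_crossing_le_one b N
  have h4 : r * ∑ i ∈ Finset.range N, μ.real (w.crossing b i) ≤ r := by nlinarith
  unfold mass errMean
  linarith

/-- The overshoot over the level `b` is `o(log b)` in mean. -/
lemma exists_jumpMean_le {ε : ℝ} (hε : 0 < ε) : ∃ M b₀, 1 ≤ b₀ ∧ ∀ b, b₀ ≤ b → ∀ N,
    w.jumpMean b N ≤ ε * Real.log b + M := by
  obtain ⟨M₁, hM₁, hmass⟩ := w.exists_log_mass_le
  have hd := w.drift_pos
  have hρ := w.ρ_pos
  have hv := w.noiseVar_nonneg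
  have hQ := w.leadSq_pos
  have hK := w.K_nonneg
  have hC := w.err_sq.C_nonneg
  have hη := w.err_sq.tsum_nonneg
  set G := (1 + w.C) * (1 + M₁) + 2 * (1 + w.C + ∑' i, w.η i) with hG
  have hGpos : 0 < G := by positivity
  set q := w.leadSq / w.drift with hq
  have hqpos : 0 < q := by positivity
  set D := q * (2 / w.ρ + G) + 2 * (w.noiseVar * G) with hD
  have hDpos : 0 < D := by positivity
  -- Makes q/r ≤ 1/2, so the mean crossing increment on the right is absorbed, and D/r ≤ ε/2, so the
  -- coefficient of log b is small.
  set r := 2 * q + 2 * D / ε with hr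
  have hrpos : 0 < r := by positivity
  have hev : ∀ᶠ b : ℝ in atTop, 2 * (Real.log b / w.ρ) < b := by
    have h1 := Real.isLittleO_log_id_atTop.def (c := w.ρ / 4) (by positivity)
    filter_upwards [h1, eventually_ge_atTop 1] with b hb hb1
    have h2 : ‖Real.log b‖ = Real.log b := by
      rw [Real.norm_eq_abs, abs_of_nonneg (Real.log_nonneg hb1)]
    rw [h2, id, Real.norm_eq_abs, abs_of_nonneg (by linarith)] at hb
    have h3 : Real.log b / w.ρ ≤ b / 4 := by
      rw [div_le_iff₀ hρ]
      linarith
    linarith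
  obtain ⟨b₁, hb₁⟩ := eventually_atTop.mp hev
  refine ⟨2 * (3 * r + w.K * M₁) + ε, max b₁ 1, le_max_right _ _, fun b hb N => ?_⟩
  have hb1 : 1 ≤ b := (le_max_right _ _).trans hb
  have hbpos : 0 < b := by linarith
  have hl : 0 ≤ Real.log b := Real.log_nonneg hb1
  -- Then exp(-ρu) = 1/b cancels the O(b) expected number of steps, while u stays of order log b.
  set u := Real.log b / w.ρ with hu
  have hu0 : 0 ≤ u := by positivity
  have hub : 2 * u < b := hb₁ b ((le_max_left _ _).trans hb)
  obtain ⟨hm1, hm2⟩ := hmass b hb1 N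
  have hm0 := w.mass_nonneg b N
  have h1 := w.jumpMean_le hu0 hub N hrpos
  have h2 := w.drift_mul_mass_sub_le (b := b) (b' := b - 2 * u) (by linarith) N
  rw [max_eq_left hbpos.le] at h2
  have h3 : w.lossMean b N ≤ G * (1 + Real.log b) := by
    have := w.lossMean_le b N
    have h4 := mul_le_mul_of_nonneg_left hm2 (by linarith : (0 : ℝ) ≤ 1 + w.C)
    have h5 : 0 ≤ (1 + w.C) * M₁ * Real.log b := by positivity
    have h6 : 0 ≤ 2 * (1 + w.C + ∑' i, w.η i) * Real.log b := by positivity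
    rw [hG]
    nlinarith
  have h4 : w.errMean b N ≤ G * (1 + Real.log b) := by
    have := w.errMean_le b N
    have h4 := mul_le_mul_of_nonneg_left hm2 (by linarith : (0 : ℝ) ≤ 1 + w.C)
    have h5 : 0 ≤ (1 + w.C) * M₁ * Real.log b := by positivity
    have h6 : 0 ≤ 2 * (1 + w.C + ∑' i, w.η i) * Real.log b := by positivity
    rw [hG]
    nlinarith
  have h5 : w.K * Real.exp (-(w.ρ * u)) * w.mass b N ≤ w.K * M₁ := by
    have h6 : w.ρ * u = Real.log b := by
      rw [hu]
      field_simp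
    rw [h6, Real.exp_neg, Real.exp_log hbpos]
    calc w.K * b⁻¹ * w.mass b N ≤ w.K * b⁻¹ * (M₁ * b) := by gcongr
      _ = w.K * M₁ := by field_simp
  set J := w.jumpMean b N with hJ
  have h6 : w.leadSq * (w.mass b N - w.mass (b - 2 * u) N)
      ≤ q * (2 * u + J + G * (1 + Real.log b)) := by
    have h7 : w.leadSq * (w.mass b N - w.mass (b - 2 * u) N)
        = q * (w.drift * (w.mass b N - w.mass (b - 2 * u) N)) := by
      rw [hq]
      field_simp
    rw [h7]
    refine mul_le_mul_of_nonneg_left ?_ hqpos.le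
    linarith
  have h7 : q * (2 * u + J + G * (1 + Real.log b)) + 2 * (w.noiseVar * w.errMean b N)
      ≤ q * J + D * (1 + Real.log b) := by
    have h8 : 2 * u ≤ 2 / w.ρ * (1 + Real.log b) := by
      rw [hu]
      have : 2 * (Real.log b / w.ρ) = 2 / w.ρ * Real.log b := by ring
      rw [this]
      gcongr
      linarith
    have h9 := mul_le_mul_of_nonneg_left h8 hqpos.le
    have h10 := mul_le_mul_of_nonneg_left h4 hv
    rw [hD]
    linarith
  have hJ0 : 0 ≤ J := by
    rw [hJ, ← w.integral_jump]
    exact integral_nonneg (w.jump_nonneg b N)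
  have h8 : r⁻¹ * (q * J + D * (1 + Real.log b)) ≤ J / 2 + ε / 2 * (1 + Real.log b) := by
    rw [inv_mul_le_iff₀ hrpos]
    have h9 : r * (J / 2 + ε / 2 * (1 + Real.log b))
        = q * J + D * (1 + Real.log b)
          + (D / ε * J + q * ε * (1 + Real.log b)) := by
      rw [hr]
      field_simp
      ring
    rw [h9]
    have : 0 ≤ D / ε * J + q * ε * (1 + Real.log b) := by positivity
    linarith
  have h9 : r⁻¹ * (w.leadSq * (w.mass b N - w.mass (b - 2 * u) N))
      + 2 * r⁻¹ * (w.noiseVar * w.errMean b N) ≤ J / 2 + ε / 2 * (1 + Real.log b) := by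
    refine le_trans ?_ h8
    have : r⁻¹ * (w.leadSq * (w.mass b N - w.mass (b - 2 * u) N))
        + 2 * r⁻¹ * (w.noiseVar * w.errMean b N)
        = r⁻¹ * (w.leadSq * (w.mass b N - w.mass (b - 2 * u) N)
          + 2 * (w.noiseVar * w.errMean b N)) := by ring
    rw [this]
    refine mul_le_mul_of_nonneg_left ?_ (by positivity)
    linarith
  linarith

/-- Upper bound for the expected crossing time. -/
lemma exists_drift_mul_mass_le {ε : ℝ} (hε : 0 < ε) : ∃ M b₀, 1 ≤ b₀ ∧ ∀ b, b₀ ≤ b → ∀ N,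
    w.drift * w.mass b N ≤ b + (w.rate + ε) * Real.log b + M := by
  obtain ⟨M₁, hM₁, hmass⟩ := w.exists_log_mass_le
  obtain ⟨M₂, b₀, hb₀, hjump⟩ := w.exists_jumpMean_le (half_pos hε)
  obtain ⟨M₃, hloss⟩ := w.loss_sum (ε / 2) (half_pos hε)
  have hrate := w.rate_nonneg
  refine ⟨M₂ + M₃ + (w.rate + ε / 2) * M₁ + (1 + w.C + ∑' i, w.η i), b₀, hb₀, fun b hb N => ?_⟩
  have hb1 : 1 ≤ b := hb₀.trans hb
  have h1 := w.drift_mul_mass_le b N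
  rw [max_eq_left (by linarith)] at h1
  have h2 := hjump b hb N
  have hm0 := w.mass_nonneg b N
  -- The random horizon is replaced by its truncated mean; the added 1 ensures m ≥ 1.
  set m := ⌈w.mass b N⌉₊ + 1 with hm
  have hm1 : w.mass b N ≤ m := (Nat.le_ceil _).trans (by rw [hm]; push_cast; linarith)
  have hm2 : (m : ℝ) ≤ w.mass b N + 2 := by
    rw [hm]
    push_cast
    linarith [Nat.ceil_lt_add_one hm0]
  have h3 : w.lossMean b N ≤ _ :=
    w.loss_control.sum_setIntegral_le (w.measurableSet_below' b) (m := m) (by omega) hm1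
  have h4 := (abs_le.mp (hloss m (by omega))).2
  have h5 : Real.log m ≤ Real.log b + M₁ :=
    (Real.log_le_log (by positivity) hm2).trans (hmass b hb1 N).2
  have h6 := mul_le_mul_of_nonneg_left h5 (by linarith : 0 ≤ w.rate + ε / 2)
  linarith

end PerturbedWalk

/-! ### The lower bound for the expected crossing time. -/

namespace PerturbedWalk

variable [mΩ : MeasurableSpace Ω] {μ : Measure Ω} (w : PerturbedWalk μ)

variable [IsProbabilityMeasure μ]

lemma setIntegral_abs_step_le {i : ℕ} {s : Set Ω} (hs : MeasurableSet[w.ℱ i] s) :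
    ∫ ω in s, |w.step i ω| ∂μ ≤ (2 + w.leadSq) * μ.real s
      + w.noiseVar * ∫ ω in s, w.err i ω ^ 2 ∂μ + ∫ ω in s, w.loss i ω ∂μ := by
  have h1 := setIntegral_abs_le (w.memLp_lead i) (Set.Subset.refl s) one_pos
  have h2 := setIntegral_abs_le (w.memLp_err_mul_noise i) (Set.Subset.refl s) one_pos
  rw [w.setIntegral_lead_sq hs] at h1
  rw [w.setIntegral_err_mul_noise_sq hs] at h2
  have i1 : Integrable (fun ω => |w.lead i ω| + |w.err i ω * w.noise i ω|) μ :=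
    (w.integrable_lead i).abs.add (w.integrable_err_mul_noise i).abs
  have i2 := w.loss_control.integrable i
  have h3 : ∫ ω in s, |w.step i ω| ∂μ
      ≤ ∫ ω in s, (|w.lead i ω| + |w.err i ω * w.noise i ω| + w.loss i ω) ∂μ := by
    refine integral_mono (w.integrable_step i).abs.integrableOn (i1.add i2).integrableOn
      fun ω => ?_
    have h4 := abs_sub (w.lead i ω + w.err i ω * w.noise i ω) (w.loss i ω)
    have h5 := abs_add_le (w.lead i ω) (w.err i ω * w.noise i ω)
    rw [abs_of_nonneg (w.loss_control.nonneg i ω)] at h4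
    exact h4.trans (by linarith)
  rw [integral_add i1.integrableOn i2.integrableOn, integral_add
    (w.integrable_lead i).abs.integrableOn (w.integrable_err_mul_noise i).abs.integrableOn] at h3
  linarith

lemma summable_below (b : ℝ) : Summable fun i => μ.real (w.below b i) := by
  obtain ⟨M, -, hM⟩ := w.exists_mass_le
  exact summable_of_sum_range_le (fun _ => measureReal_nonneg) (hM b)

lemma mass_le_tsum (b : ℝ) (N : ℕ) : w.mass b N ≤ ∑' i, μ.real (w.below b i) :=
  (w.summable_below b).sum_le_tsum _ fun _ _ => measureReal_nonneg

/-- The absolute increments up to the crossing time have a finite mean sum; this is the dominating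
series that justifies optional stopping without truncation. -/
lemma summable_setIntegral_abs_step (b : ℝ) :
    Summable fun i => ∫ ω in w.below b i, |w.step i ω| ∂μ := by
  set t := ∑' i, μ.real (w.below b i)
  set G := (1 + w.C) * Real.log (t + 2) + 2 * (1 + w.C + ∑' i, w.η i)
  have hG : ∀ N, (1 + w.C) * Real.log (w.mass b N + 2) + 2 * (1 + w.C + ∑' i, w.η i) ≤ G := by
    intro N
    have h1 := w.mass_nonneg b N
    have h2 := w.err_sq.C_nonneg
    have h3 : Real.log (w.mass b N + 2) ≤ Real.log (t + 2) :=
      Real.log_le_log (by linarith) (by linarith [w.mass_le_tsum b N])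
    have := mul_le_mul_of_nonneg_left h3 (by linarith : (0 : ℝ) ≤ 1 + w.C)
    linarith
  refine summable_of_sum_range_le (c := (2 + w.leadSq) * t + w.noiseVar * G + G)
    (fun i => integral_nonneg fun _ => abs_nonneg _) fun N => ?_
  have h := Finset.sum_le_sum fun i (_ : i ∈ Finset.range N) =>
    w.setIntegral_abs_step_le (w.measurableSet_below b i)
  refine h.trans ?_
  simp only [Finset.sum_add_distrib, ← Finset.mul_sum]
  have h1 := w.mass_le_tsum b N
  have h2 := (w.errMean_le b N).trans (hG N)
  have h3 := (w.lossMean_le b N).trans (hG N)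
  have h4 := w.leadSq_pos
  have h5 := w.noiseVar_nonneg
  have h6 := mul_le_mul_of_nonneg_left h1 (by linarith : 0 ≤ 2 + w.leadSq)
  have h7 := mul_le_mul_of_nonneg_left h2 h5
  unfold mass at h6
  unfold errMean at h7
  unfold lossMean at h3
  linarith

lemma tendsto_measureReal_below (b : ℝ) :
    Tendsto (fun N => μ.real (w.below b N)) atTop (𝓝 0) :=
  (w.summable_below b).tendsto_atTop_zero

/-- Dominated convergence for series: each term vanishes because P(τ_b > N) → 0, and for i < N it is
dominated by the integral over the larger event {τ_b > i}. -/
lemma tendsto_sum_setIntegral_abs_step (b : ℝ) :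
    Tendsto (fun N => ∑ i ∈ Finset.range N, ∫ ω in w.below b N, |w.step i ω| ∂μ) atTop (𝓝 0) := by
  have h1 := tendsto_tsum_of_dominated_convergence (𝓕 := (atTop : Filter ℕ))
    (f := fun N i => if i < N then ∫ ω in w.below b N, |w.step i ω| ∂μ else 0)
    (g := fun _ => (0 : ℝ)) (w.summable_setIntegral_abs_step b) ?_ ?_
  · rw [tsum_zero] at h1
    refine h1.congr fun N => ?_
    rw [tsum_eq_sum (s := Finset.range N)]
    · exact Finset.sum_congr rfl fun i hi => if_pos (Finset.mem_range.mp hi)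
    · intro i hi
      exact if_neg fun h => hi (Finset.mem_range.mpr h)
  · intro i
    have hz : Tendsto (μ ∘ w.below b) atTop (𝓝 0) := by
      have h2 := (ENNReal.tendsto_ofReal (w.tendsto_measureReal_below b))
      rw [ENNReal.ofReal_zero] at h2
      refine h2.congr fun N => ?_
      simp [measureReal_def]
    have h3 := (w.integrable_step i).abs.tendsto_setIntegral_nhds_zero hz
    refine h3.congr' ?_
    filter_upwards [eventually_gt_atTop i] with N hN
    rw [if_pos hN]
  · refine Eventually.of_forall fun N i => ?_
    by_cases h : i < N
    · rw [if_pos h, Real.norm_of_nonneg (integral_nonneg fun _ => abs_nonneg _)]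
      exact setIntegral_mono_set (w.integrable_step i).abs.integrableOn
        (ae_of_all _ fun _ => abs_nonneg _) (w.below_antitone b h.le).eventuallyLE
    · rw [if_neg h, norm_zero]
      exact integral_nonneg fun _ => abs_nonneg _

/-- The stopped walk is at least b once the level has been reached; otherwise it is at least minus
the sum of the absolute increments. The correction vanishes as N → ∞. -/
lemma le_integral_stopped (b : ℝ) (N : ℕ) :
    b - (|b| * μ.real (w.below b N) + ∑ i ∈ Finset.range N, ∫ ω in w.below b N, |w.step i ω| ∂μ)
      ≤ ∫ ω, w.stopped b N ω ∂μ := by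
  have hB := w.measurableSet_below' b N
  have i1 : Integrable (fun ω => |b| + ∑ i ∈ Finset.range N, |w.step i ω|) μ :=
    (integrable_const _).add (integrable_finsetSum _ fun i _ => (w.integrable_step i).abs)
  have h1 : ∫ ω, (b - (w.below b N).indicator
      (fun ω => |b| + ∑ i ∈ Finset.range N, |w.step i ω|) ω) ∂μ ≤ ∫ ω, w.stopped b N ω ∂μ := by
    refine integral_mono ((integrable_const b).sub (i1.indicator hB)) (w.integrable_stopped b N)
      fun ω => ?_
    by_cases h : ω ∈ w.below b N
    · simp only [Set.indicator_of_mem h]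
      rw [w.stopped_eq_walk h]
      have h2 := Finset.abs_sum_le_sum_abs (fun i => w.step i ω) (Finset.range N)
      have h3 := neg_abs_le (w.walk N ω)
      have h4 := le_abs_self b
      unfold walk at h3 ⊢
      linarith
    · simp only [Set.indicator_of_notMem h, sub_zero]
      exact w.le_stopped h
  rw [integral_sub (integrable_const b) (i1.indicator hB), integral_indicator hB,
    integral_add (integrable_const _).integrableOn
      (integrable_finsetSum _ fun i _ => (w.integrable_step i).abs).integrableOn,
    integral_finsetSum _ fun i _ => (w.integrable_step i).abs.integrableOn] at h1
  simp only [integral_const, measureReal_restrict_apply_univ, smul_eq_mul, probReal_univ,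
    one_mul] at h1
  rw [mul_comm |b|]
  exact h1

/-- The optional stopping lower bound: the crossing time pays for the level and the loss. -/
lemma add_lossMean_le (b : ℝ) (m : ℕ) :
    b + w.lossMean b m ≤ w.drift * ∑' i, μ.real (w.below b i) := by
  have h1 : Tendsto (fun N => b - (|b| * μ.real (w.below b N)
      + ∑ i ∈ Finset.range N, ∫ ω in w.below b N, |w.step i ω| ∂μ) + w.lossMean b m) atTop
      (𝓝 (b - (|b| * 0 + 0) + w.lossMean b m)) :=
    (tendsto_const_nhds.sub (((w.tendsto_measureReal_below b).const_mul _).add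
      (w.tendsto_sum_setIntegral_abs_step b))).add_const _
  have h2 := le_of_tendsto h1 (b := w.drift * ∑' i, μ.real (w.below b i)) ?_
  · simpa using h2
  · filter_upwards [eventually_ge_atTop m] with N hN
    have h3 := w.le_integral_stopped b N
    rw [w.integral_stopped] at h3
    -- Losses are nonnegative, so a fixed number m of them may be kept while N tends to infinity.
    have h4 : w.lossMean b m ≤ w.lossMean b N :=
      Finset.sum_le_sum_of_subset_of_nonneg (Finset.range_mono hN)
        fun i _ _ => w.loss_control.setIntegral_nonneg _ _
    have h5 := mul_le_mul_of_nonneg_left (w.mass_le_tsum b N) w.drift_pos.le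
    linarith

/-- Crossing `b` within `m` steps has probability `O(m / b)`. -/
lemma exists_measureReal_compl_below_le : ∃ M, 0 < M ∧ ∀ b, 0 < b → ∀ m : ℕ,
    μ.real (w.below b m)ᶜ ≤ M * m / b := by
  have hC := w.err_sq.C_nonneg
  have hη := w.err_sq.tsum_nonneg
  have hv := w.noiseVar_nonneg
  have hl := w.leadSq_pos
  refine ⟨(1 + w.leadSq) + (1 + w.noiseVar * (1 + w.C + ∑' i, w.η i)), by positivity,
    fun b hb m => ?_⟩
  set M := (1 + w.leadSq) + (1 + w.noiseVar * (1 + w.C + ∑' i, w.η i)) with hM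
  set g : ℕ → Ω → ℝ := fun i ω => |w.lead i ω| + |w.err i ω * w.noise i ω| with hg
  have hgi : ∀ i, Integrable (g i) μ := fun i =>
    (w.integrable_lead i).abs.add (w.integrable_err_mul_noise i).abs
  have hgM : ∀ i, ∫ ω, g i ω ∂μ ≤ M := by
    intro i
    have h1 := setIntegral_abs_le (w.memLp_lead i) (Set.Subset.refl Set.univ) one_pos
    have h2 := setIntegral_abs_le (w.memLp_err_mul_noise i) (Set.Subset.refl Set.univ) one_pos
    rw [w.setIntegral_lead_sq MeasurableSet.univ] at h1
    rw [w.setIntegral_err_mul_noise_sq MeasurableSet.univ] at h2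
    have h3 := w.err_sq.setIntegral_le i Set.univ 1 MeasurableSet.univ one_pos
    have h4 : w.C / (1 * ((i : ℝ) + 1) ^ 2) ≤ w.C := by
      refine div_le_self hC ?_
      rw [one_mul]
      have : (0 : ℝ) ≤ i := Nat.cast_nonneg i
      nlinarith
    have h5 : w.η i ≤ ∑' i, w.η i :=
      w.err_sq.summable_η.le_tsum i fun j _ => w.err_sq.η_nonneg j
    simp only [setIntegral_univ, probReal_univ, mul_one, inv_one, one_mul] at h1 h2 h3 h4
    have h6 := mul_le_mul_of_nonneg_left
      (h3.trans (by linarith : _ ≤ 1 + w.C + ∑' i, w.η i)) hv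
    have h7 : ∫ ω, g i ω ∂μ = ∫ ω, |w.lead i ω| ∂μ + ∫ ω, |w.err i ω * w.noise i ω| ∂μ :=
      integral_add (w.integrable_lead i).abs (w.integrable_err_mul_noise i).abs
    rw [h7, hM]
    linarith
  -- The loss only lowers the walk, so the path up to time m is dominated by a sum of m nonnegative
  -- terms of bounded mean, and Markov's inequality applies.
  have hsub : (w.below b m)ᶜ ⊆ {ω | b ≤ ∑ i ∈ Finset.range m, g i ω} := by
    intro ω hω
    simp only [below, Set.mem_compl_iff, Set.mem_ofPred_eq, not_forall, not_lt] at hω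
    obtain ⟨n, hn1, hnm, hn⟩ := hω
    refine hn.trans ?_
    unfold walk
    refine (Finset.sum_le_sum fun i _ => (le_max_left _ _).trans (w.max_step_le i ω)).trans ?_
    exact Finset.sum_le_sum_of_subset_of_nonneg (Finset.range_mono hnm)
      fun i _ _ => by positivity
  have h1 := mul_meas_ge_le_integral_of_nonneg (μ := μ)
    (f := fun ω => ∑ i ∈ Finset.range m, g i ω)
    (ae_of_all _ fun ω => Finset.sum_nonneg fun i _ => by positivity)
    (integrable_finsetSum _ fun i _ => hgi i) b
  rw [integral_finsetSum _ fun i _ => hgi i] at h1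
  have h2 : ∑ i ∈ Finset.range m, ∫ ω, g i ω ∂μ ≤ M * m := by
    refine (Finset.sum_le_sum fun i _ => hgM i).trans (le_of_eq ?_)
    simp [mul_comm]
  rw [le_div_iff₀ hb]
  calc μ.real (w.below b m)ᶜ * b ≤ μ.real {ω | b ≤ ∑ i ∈ Finset.range m, g i ω} * b := by
        gcongr
        exact measure_ne_top _ _
    _ = b * μ.real {ω | b ≤ ∑ i ∈ Finset.range m, g i ω} := mul_comm _ _
    _ ≤ M * m := h1.trans h2

/-- Lower bound for the expected crossing time. -/
lemma exists_le_drift_mul_tsum {ε : ℝ} (hε : 0 < ε) : ∃ M b₀, 1 ≤ b₀ ∧ ∀ b, b₀ ≤ b →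
    b + (w.rate - ε) * Real.log b - M ≤ w.drift * ∑' i, μ.real (w.below b i) := by
  obtain ⟨B, hB, hprob⟩ := w.exists_measureReal_compl_below_le
  obtain ⟨M₃, hloss⟩ := w.loss_sum (ε / 2) (half_pos hε)
  have hrate := w.rate_nonneg
  have hC := w.err_sq.C_nonneg
  -- γ gives (1+C)γ = ε/2 in `sum_setIntegral_le_log`, and δ below makes the probability of crossing
  -- within δb steps at most γ².
  set γ := ε / (2 * (1 + w.C)) with hγ
  have hγpos : 0 < γ := by positivity
  set δ := min 1 (γ ^ 2 / B) with hδ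
  have hδpos : 0 < δ := by positivity
  refine ⟨M₃ + ε / 2 + (∑' i, w.η i) + w.rate * |Real.log (δ / 2)|, max 1 (2 / δ), le_max_left _ _,
    fun b hb => ?_⟩
  have hb1 : 1 ≤ b := (le_max_left _ _).trans hb
  have hb0 : 0 < b := by linarith
  have hb2 : 2 ≤ δ * b := by
    have := (le_max_right _ _).trans hb
    rw [div_le_iff₀ hδpos] at this
    linarith
  set m := ⌊δ * b⌋₊ with hm
  have hm1 : (m : ℝ) ≤ δ * b := Nat.floor_le (by positivity)
  have hm2 : δ / 2 * b ≤ m := by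
    have := Nat.lt_floor_add_one (δ * b)
    rw [← hm] at this
    linarith
  have hm3 : (1 : ℝ) ≤ m := by linarith
  have hm4 : 1 ≤ m := by exact_mod_cast hm3
  have hlog1 : Real.log m ≤ Real.log b := by
    refine Real.log_le_log (by linarith) (hm1.trans ?_)
    have : δ ≤ 1 := min_le_left _ _
    nlinarith
  have hlog0 : 0 ≤ Real.log m := Real.log_nonneg hm3
  have hlog2 : Real.log b - |Real.log (δ / 2)| ≤ Real.log m := by
    have h1 := Real.log_le_log (by positivity) hm2
    rw [Real.log_mul (by positivity) (by positivity)] at h1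
    linarith [neg_abs_le (Real.log (δ / 2))]
  have hsmall : μ.real (w.below b m)ᶜ ≤ γ ^ 2 := by
    refine (hprob b hb0 m).trans ?_
    rw [div_le_iff₀ hb0]
    calc B * m ≤ B * (δ * b) := by gcongr
      _ ≤ B * (γ ^ 2 / B * b) := by
        gcongr
        exact min_le_right _ _
      _ = γ ^ 2 * b := by field_simp
  have h1 := w.loss_control.sum_setIntegral_le_log (w.measurableSet_below' b m).compl hγpos hsmall m
  have h2 : ∑ i ∈ Finset.range m, ∫ ω, w.loss i ω ∂μ
      - ∑ i ∈ Finset.range m, ∫ ω in (w.below b m)ᶜ, w.loss i ω ∂μ ≤ w.lossMean b m := by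
    unfold lossMean
    rw [← Finset.sum_sub_distrib]
    refine Finset.sum_le_sum fun i hi => ?_
    have h3 := integral_add_compl (w.measurableSet_below' b m) (w.loss_control.integrable i)
    have h4 := w.loss_control.setIntegral_mono i
      (w.below_antitone b (Finset.mem_range.mp hi).le)
    linarith
  have h3 := (abs_le.mp (hloss m hm4)).1
  have h4 := w.add_lossMean_le b m
  have h5 : (1 + w.C) * γ = ε / 2 := by
    rw [hγ]
    field_simp
  rw [h5] at h1
  have h6 := mul_le_mul_of_nonneg_left hlog2 hrate
  have h7 := mul_le_mul_of_nonneg_left hlog1 hε.le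
  linarith

/-- The expected crossing time of a perturbed walk, up to `o(log b)`. -/
theorem isLittleO_crossing :
    (fun b : ℝ => ∑' i, μ.real (w.below b i) - w.drift⁻¹ * (b + w.rate * Real.log b))
      =o[atTop] fun b : ℝ => Real.log b := by
  have hd := w.drift_pos
  rw [isLittleO_iff]
  intro c hc
  have hε : 0 < w.drift * c / 2 := by positivity
  obtain ⟨M₁, b₁, hb₁, hup⟩ := w.exists_drift_mul_mass_le hε
  obtain ⟨M₂, b₂, hb₂, hlow⟩ := w.exists_le_drift_mul_tsum hε
  have hlog := Real.tendsto_log_atTop.eventually_ge_atTop ((|M₁| + |M₂|) / (w.drift * c / 2))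
  filter_upwards [eventually_ge_atTop b₁, eventually_ge_atTop b₂, hlog] with b h1 h2 h3
  rw [div_le_iff₀ hε] at h3
  have h4 : w.drift * ∑' i, μ.real (w.below b i)
      ≤ b + (w.rate + w.drift * c / 2) * Real.log b + M₁ := by
    have h5 : Tendsto (fun N => w.drift * w.mass b N) atTop
        (𝓝 (w.drift * ∑' i, μ.real (w.below b i))) :=
      (w.summable_below b).hasSum.tendsto_sum_nat.const_mul _
    exact le_of_tendsto h5 (Eventually.of_forall (hup b h1))
  have h5 := hlow b h2
  have hl : 0 ≤ Real.log b := Real.log_nonneg (hb₁.trans h1)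
  rw [Real.norm_of_nonneg hl, Real.norm_eq_abs]
  have h6 : ∑' i, μ.real (w.below b i) - w.drift⁻¹ * (b + w.rate * Real.log b)
      = w.drift⁻¹ * (w.drift * ∑' i, μ.real (w.below b i) - (b + w.rate * Real.log b)) := by
    field_simp
  rw [h6, abs_mul, abs_of_pos (inv_pos.mpr hd), inv_mul_le_iff₀ hd, abs_le]
  have := le_abs_self M₁
  have := le_abs_self M₂
  have := abs_nonneg M₁
  have := abs_nonneg M₂
  constructor <;> linarith

end PerturbedWalk

/-! ### The logarithm of the Gamma function and the Gamma distribution -/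

/-- The logarithm of the Gamma function. -/
def logGamma (t : ℝ) : ℝ := Real.log (Real.Gamma t)

lemma measurable_gammaPDF (θ : ℝ) : Measurable (gammaPDF θ 1) :=
  (measurable_gammaPDFReal θ 1).ennreal_ofReal

lemma ae_pos_gammaMeasure (θ : ℝ) : ∀ᵐ x ∂(gammaMeasure θ 1), 0 < x := by
  have h0 : ∀ᵐ x : ℝ ∂volume, x ≠ 0 := by
    simp [ae_iff, measure_singleton]
  rw [gammaMeasure, ae_withDensity_iff (measurable_gammaPDF θ)]
  filter_upwards [h0] with x hx hx'
  rcases lt_trichotomy x 0 with h | h | h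
  · exact absurd (gammaPDF_of_neg h) hx'
  · exact absurd h hx
  · exact h

/-- Multiplying the Gamma(θ,1) density by x^s gives a multiple of the Gamma(θ+s,1) density. -/
lemma lintegral_exp_mul_log {θ s : ℝ} (hθ : 0 < θ) (hs : 0 < θ + s) :
    ∫⁻ x, ENNReal.ofReal (Real.exp (s * Real.log x)) ∂(gammaMeasure θ 1)
      = ENNReal.ofReal (Real.Gamma (θ + s) / Real.Gamma θ) := by
  have hΓ := Real.Gamma_pos_of_pos hθ
  have hΓs := Real.Gamma_pos_of_pos hs
  rw [gammaMeasure, lintegral_withDensity_eq_lintegral_mul _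
    (measurable_gammaPDF θ) (by fun_prop)]
  have h0 : ∀ᵐ x : ℝ ∂volume, x ≠ 0 := by
    simp [ae_iff, measure_singleton]
  have h : ∀ᵐ x : ℝ ∂volume,
      (gammaPDF θ 1 * fun x => ENNReal.ofReal (Real.exp (s * Real.log x))) x
      = ENNReal.ofReal (Real.Gamma (θ + s) / Real.Gamma θ) * gammaPDF (θ + s) 1 x := by
    filter_upwards [h0] with x hx
    rcases lt_or_gt_of_ne hx with h | h
    · simp [gammaPDF_of_neg h]
    · rw [Pi.mul_apply, gammaPDF_of_nonneg h.le, gammaPDF_of_nonneg h.le,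
        ← ENNReal.ofReal_mul (by positivity), ← ENNReal.ofReal_mul (by positivity)]
      congr 1
      have hx1 : Real.exp (s * Real.log x) = x ^ s := by
        rw [Real.rpow_def_of_pos h, mul_comm]
      have hx2 : x ^ (θ + s - 1) = x ^ (θ - 1) * x ^ s := by
        rw [← Real.rpow_add h]
        ring_nf
      rw [hx1, hx2, Real.one_rpow, Real.one_rpow]
      field_simp
  rw [lintegral_congr_ae h, lintegral_const_mul _ (measurable_gammaPDF _),
    lintegral_gammaPDF_eq_one hs one_pos, mul_one]

lemma integrable_exp_mul_log {θ s : ℝ} (hθ : 0 < θ) (hs : 0 < θ + s) :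
    Integrable (fun x => Real.exp (s * Real.log x)) (gammaMeasure θ 1) := by
  refine ⟨by fun_prop, ?_⟩
  rw [hasFiniteIntegral_iff_ofReal (ae_of_all _ fun x => (Real.exp_pos _).le),
    lintegral_exp_mul_log hθ hs]
  exact ENNReal.ofReal_lt_top

lemma mgf_log {θ s : ℝ} (hθ : 0 < θ) (hs : 0 < θ + s) :
    mgf Real.log (gammaMeasure θ 1) s = Real.Gamma (θ + s) / Real.Gamma θ := by
  have hΓ := Real.Gamma_pos_of_pos hθ
  have hΓs := Real.Gamma_pos_of_pos hs
  rw [mgf, integral_eq_lintegral_of_nonneg_ae (ae_of_all _ fun x => (Real.exp_pos _).le)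
    (by fun_prop), lintegral_exp_mul_log hθ hs, ENNReal.toReal_ofReal (by positivity)]

/-- Identifies log Γ, up to shift and constant, with the cumulant generating function of log X. Its
analyticity, and its first two derivatives as mean and variance of log X, follow from the general
theory. -/
lemma cgf_log {θ s : ℝ} (hθ : 0 < θ) (hs : 0 < θ + s) :
    cgf Real.log (gammaMeasure θ 1) s = logGamma (θ + s) - logGamma θ := by
  rw [cgf, mgf_log hθ hs, Real.log_div (Real.Gamma_pos_of_pos hs).ne'
    (Real.Gamma_pos_of_pos hθ).ne']
  rfl

lemma zero_mem_interior_integrableExpSet_log {θ : ℝ} (hθ : 0 < θ) :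
    0 ∈ interior (integrableExpSet Real.log (gammaMeasure θ 1)) := by
  rw [mem_interior]
  refine ⟨Set.Ioi (-θ), fun s hs => ?_, isOpen_Ioi, by simpa using hθ⟩
  exact integrable_exp_mul_log hθ (by linarith [Set.mem_Ioi.mp hs])

lemma memLp_log_gammaMeasure {θ : ℝ} (hθ : 0 < θ) : MemLp Real.log 2 (gammaMeasure θ 1) :=
  memLp_of_mem_interior_integrableExpSet (zero_mem_interior_integrableExpSet_log hθ) 2

lemma integrable_log_gammaMeasure {θ : ℝ} (hθ : 0 < θ) :
    Integrable Real.log (gammaMeasure θ 1) :=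
  integrable_of_mem_interior_integrableExpSet (zero_mem_interior_integrableExpSet_log hθ)

lemma logGamma_eventuallyEq {θ : ℝ} (hθ : 0 < θ) :
    (fun s => logGamma (θ + s)) =ᶠ[𝓝 0]
      fun s => cgf Real.log (gammaMeasure θ 1) s + logGamma θ := by
  filter_upwards [eventually_gt_nhds (show (-θ : ℝ) < 0 by linarith)] with s hs
  rw [cgf_log hθ (by linarith)]
  ring

lemma analyticAt_logGamma {θ : ℝ} (hθ : 0 < θ) : AnalyticAt ℝ logGamma θ := by
  have h1 : AnalyticAt ℝ (fun s => logGamma (θ + s)) 0 :=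
    ((analyticAt_cgf (zero_mem_interior_integrableExpSet_log hθ)).add analyticAt_const).congr
      (logGamma_eventuallyEq hθ).symm
  have h2 : AnalyticAt ℝ (fun t : ℝ => t - θ) θ := analyticAt_id.sub analyticAt_const
  have h3 := h1.comp_of_eq h2 (by simp)
  refine h3.congr (Eventually.of_forall fun t => ?_)
  simp

lemma deriv_logGamma {θ : ℝ} (hθ : 0 < θ) :
    deriv logGamma θ = ∫ x, Real.log x ∂(gammaMeasure θ 1) := by
  have := isProbabilityMeasure_gammaMeasure hθ one_pos
  have h1 := deriv_comp_const_add logGamma θ 0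
  rw [(logGamma_eventuallyEq hθ).deriv_eq, deriv_add_const, add_zero,
    deriv_cgf_zero (zero_mem_interior_integrableExpSet_log hθ)] at h1
  rw [← h1]
  simp

lemma iteratedDeriv_two_logGamma {θ : ℝ} (hθ : 0 < θ) :
    iteratedDeriv 2 logGamma θ
      = ∫ x, (Real.log x - deriv logGamma θ) ^ 2 ∂(gammaMeasure θ 1) := by
  have := isProbabilityMeasure_gammaMeasure hθ one_pos
  have h0 := zero_mem_interior_integrableExpSet_log hθ
  have h1 := congrFun (iteratedDeriv_comp_const_add 2 logGamma θ) 0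
  have h2 : deriv (fun s => logGamma (θ + s)) =ᶠ[𝓝 0] deriv (cgf Real.log (gammaMeasure θ 1)) := by
    refine (logGamma_eventuallyEq hθ).deriv.trans (Eventually.of_forall fun s => ?_)
    exact deriv_add_const _
  have h3 : iteratedDeriv 2 (fun s => logGamma (θ + s)) 0
      = iteratedDeriv 2 (cgf Real.log (gammaMeasure θ 1)) 0 := by
    simp only [iteratedDeriv_succ, iteratedDeriv_zero]
    exact h2.deriv_eq
  have h4 : deriv (cgf Real.log (gammaMeasure θ 1)) 0 = deriv logGamma θ := by
    rw [deriv_cgf_zero h0, deriv_logGamma hθ]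
    simp
  rw [h3, iteratedDeriv_two_cgf_eq_integral h0, h4] at h1
  simp only [add_zero] at h1
  rw [← h1, mgf_zero]
  simp

/-- A zero variance would concentrate the Gamma law at one point, but it has a density. -/
lemma iteratedDeriv_two_logGamma_pos {θ : ℝ} (hθ : 0 < θ) : 0 < iteratedDeriv 2 logGamma θ := by
  have := isProbabilityMeasure_gammaMeasure hθ one_pos
  rw [iteratedDeriv_two_logGamma hθ]
  set m := deriv logGamma θ
  have hint : Integrable (fun x => (Real.log x - m) ^ 2) (gammaMeasure θ 1) :=
    ((memLp_log_gammaMeasure hθ).sub (memLp_const m)).integrable_sq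
  refine lt_of_le_of_ne (integral_nonneg fun x => sq_nonneg _) fun h => ?_
  rw [eq_comm, integral_eq_zero_iff_of_nonneg (fun x => sq_nonneg _) hint] at h
  have h1 : ∀ᵐ x ∂(gammaMeasure θ 1), x = Real.exp m := by
    filter_upwards [h, ae_pos_gammaMeasure θ] with x hx hx0
    have h2 : Real.log x = m := by
      have : (Real.log x - m) ^ 2 = 0 := hx
      have := pow_eq_zero_iff (two_ne_zero) |>.mp this
      linarith
    rw [← h2, Real.exp_log hx0]
  have h2 : ∀ᵐ x ∂(gammaMeasure θ 1), x ≠ Real.exp m := by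
    have h3 : ∀ᵐ x : ℝ ∂volume, x ≠ Real.exp m := by
      simp [ae_iff, measure_singleton]
    exact (withDensity_absolutelyContinuous volume (gammaPDF θ 1)).ae_le h3
  obtain ⟨x, hx1, hx2⟩ := (h1.and h2).exists
  exact hx2 hx1

lemma strictConvexOn_logGamma : StrictConvexOn ℝ (Set.Ioi 0) logGamma := by
  refine strictConvexOn_of_deriv2_pos' (convex_Ioi 0)
    (fun x hx => (analyticAt_logGamma hx).continuousAt.continuousWithinAt) fun x hx => ?_
  have := iteratedDeriv_two_logGamma_pos hx
  rwa [iteratedDeriv_eq_iterate] at this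

lemma fisherInfo_eq {θ : ℝ} (hθ : 0 < θ) : fisherInfo θ = iteratedDeriv 2 logGamma θ := by
  have := isProbabilityMeasure_gammaMeasure hθ one_pos
  have h : ∀ᵐ x ∂(gammaMeasure θ 1),
      iteratedDeriv 2 (fun t => Real.log (gammaPDFReal t 1 x)) θ
        = -iteratedDeriv 2 logGamma θ := by
    filter_upwards [ae_pos_gammaMeasure θ] with x hx
    have h1 : (fun t => Real.log (gammaPDFReal t 1 x)) =ᶠ[𝓝 θ]
        fun t => ((t - 1) * Real.log x - x) - logGamma t := by
      filter_upwards [eventually_gt_nhds hθ] with t ht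
      have hΓ := Real.Gamma_pos_of_pos ht
      rw [gammaPDFReal, if_pos hx.le, Real.one_rpow, Real.log_mul (by positivity) (by positivity),
        Real.log_mul (by positivity) (by positivity), Real.log_div one_ne_zero hΓ.ne',
        Real.log_one, Real.log_exp, Real.log_rpow hx, logGamma]
      ring
    have h2 : deriv (fun t => Real.log (gammaPDFReal t 1 x)) =ᶠ[𝓝 θ]
        fun t => Real.log x - deriv logGamma t := by
      refine h1.deriv.trans ?_
      filter_upwards [eventually_gt_nhds hθ] with t ht
      have h3 : HasDerivAt (fun t : ℝ => (t - 1) * Real.log x - x) (Real.log x) t := by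
        simpa using (((hasDerivAt_id t).sub_const 1).mul_const (Real.log x)).sub_const x
      exact (h3.sub (analyticAt_logGamma ht).differentiableAt.hasDerivAt).deriv
    simp only [iteratedDeriv_succ, iteratedDeriv_zero]
    rw [h2.deriv_eq, deriv_const_sub]
  rw [fisherInfo, integral_congr_ae h]
  simp

lemma klInfo_eq {θ φ : ℝ} (hθ : 0 < θ) (hφ : 0 < φ) :
    klInfo θ φ = (θ - φ) * deriv logGamma θ - (logGamma θ - logGamma φ) := by
  have := isProbabilityMeasure_gammaMeasure hθ one_pos
  have h : ∀ᵐ x ∂(gammaMeasure θ 1), Real.log (gammaPDFReal θ 1 x / gammaPDFReal φ 1 x)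
      = (θ - φ) * Real.log x - (logGamma θ - logGamma φ) := by
    filter_upwards [ae_pos_gammaMeasure θ] with x hx
    have hΓ := Real.Gamma_pos_of_pos hθ
    have hΓ' := Real.Gamma_pos_of_pos hφ
    rw [Real.log_div (gammaPDFReal_pos hθ one_pos hx).ne' (gammaPDFReal_pos hφ one_pos hx).ne']
    rw [gammaPDFReal, gammaPDFReal, if_pos hx.le, if_pos hx.le, Real.one_rpow, Real.one_rpow,
      Real.log_mul (by positivity) (by positivity), Real.log_mul (by positivity) (by positivity),
      Real.log_mul (by positivity) (by positivity), Real.log_mul (by positivity) (by positivity),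
      Real.log_div one_ne_zero hΓ.ne', Real.log_div one_ne_zero hΓ'.ne',
      Real.log_rpow hx, Real.log_rpow hx, logGamma, logGamma]
    ring
  rw [klInfo, integral_congr_ae h, integral_sub ((integrable_log_gammaMeasure hθ).const_mul _)
    (integrable_const _), integral_const_mul, ← deriv_logGamma hθ]
  simp

/-! ### The Kullback–Leibler loss of an estimate -/

/-- The Kullback–Leibler information `I(θ, φ)` as a function of `φ`, extended by zero. -/
def klLoss (θ φ : ℝ) : ℝ :=
  if 0 < φ then logGamma φ - logGamma θ - deriv logGamma θ * (φ - θ) else 0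

lemma klLoss_of_pos (θ : ℝ) {φ : ℝ} (hφ : 0 < φ) :
    klLoss θ φ = logGamma φ - logGamma θ - deriv logGamma θ * (φ - θ) := if_pos hφ

lemma klInfo_eq_klLoss {θ φ : ℝ} (hθ : 0 < θ) (hφ : 0 < φ) : klInfo θ φ = klLoss θ φ := by
  rw [klInfo_eq hθ hφ, klLoss_of_pos θ hφ]
  ring

/-- A strictly convex function lies strictly above its tangent line away from the point of contact.
-/
lemma klLoss_pos {θ φ : ℝ} (hθ : 0 < θ) (hφ : 0 < φ) (hne : φ ≠ θ) : 0 < klLoss θ φ := by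
  rw [klLoss_of_pos θ hφ]
  have hd := (analyticAt_logGamma hθ).differentiableAt
  rcases lt_or_gt_of_ne hne with h | h
  · have h1 := strictConvexOn_logGamma.slope_lt_deriv (x := φ) (y := θ) hφ hθ h hd
    rw [slope_def_field, div_lt_iff₀ (by linarith)] at h1
    linarith
  · have h1 := strictConvexOn_logGamma.deriv_lt_slope (x := θ) (y := φ) hθ hφ h hd
    rw [slope_def_field, lt_div_iff₀ (by linarith)] at h1
    linarith

lemma klLoss_self (θ : ℝ) : klLoss θ θ = 0 := by
  unfold klLoss
  split_ifs <;> simp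

lemma klLoss_nonneg {θ : ℝ} (hθ : 0 < θ) (φ : ℝ) : 0 ≤ klLoss θ φ := by
  by_cases hφ : 0 < φ
  · by_cases hne : φ = θ
    · rw [hne, klLoss_self]
    · exact (klLoss_pos hθ hφ hne).le
  · rw [klLoss, if_neg hφ]

lemma measurable_klLoss (θ : ℝ) : Measurable (klLoss θ) := by
  have hc : ContinuousOn logGamma (Set.Ioi 0) :=
    fun x hx => (analyticAt_logGamma hx).continuousAt.continuousWithinAt
  have hc' : ContinuousOn (fun φ => logGamma φ - logGamma θ - deriv logGamma θ * (φ - θ))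
      (Set.Ioi 0) := (hc.sub continuousOn_const).sub (by fun_prop)
  have h := hc'.measurable_piecewise (g := fun _ => (0 : ℝ)) continuousOn_const measurableSet_Ioi
  have h2 : klLoss θ = (Set.Ioi 0).piecewise
      (fun φ => logGamma φ - logGamma θ - deriv logGamma θ * (φ - θ)) (fun _ => (0 : ℝ)) := by
    ext φ
    by_cases hφ : 0 < φ
    · rw [klLoss_of_pos θ hφ, Set.piecewise_eq_of_mem _ _ _ (show φ ∈ Set.Ioi 0 from hφ)]
    · rw [klLoss, if_neg hφ, Set.piecewise_eq_of_notMem _ _ _ (show φ ∉ Set.Ioi 0 from hφ)]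
  rw [h2]
  exact h

/-- Second order expansion of the loss at the true parameter. -/
lemma exists_abs_klLoss_sub_le_of_near {θ : ℝ} (hθ : 0 < θ) {ε : ℝ} (hε : 0 < ε) :
    ∃ δ, 0 < δ ∧ ∀ φ, 0 < φ → |φ - θ| < δ →
      |klLoss θ φ - iteratedDeriv 2 logGamma θ / 2 * (φ - θ) ^ 2| ≤ ε * (φ - θ) ^ 2 := by
  set J := iteratedDeriv 2 logGamma θ with hJ
  have h2 : HasDerivAt (deriv logGamma) J θ := by
    have h := (analyticAt_logGamma hθ).deriv.differentiableAt.hasDerivAt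
    rwa [hJ, iteratedDeriv_succ, iteratedDeriv_one]
  have h3 := (hasDerivAt_iff_isLittleO.mp h2).def hε
  obtain ⟨δ₁, hδ₁, hball⟩ := Metric.eventually_nhds_iff.mp h3
  -- The bound θ keeps the closed ball of radius |φ-θ| inside the positive half-line, where the mean
  -- value inequality is applied to the Taylor remainder.
  refine ⟨min δ₁ θ, by positivity, fun φ hφ hφδ => ?_⟩
  set g : ℝ → ℝ := fun t =>
    logGamma t - logGamma θ - deriv logGamma θ * (t - θ) - J / 2 * (t - θ) ^ 2 with hg
  have hseg : ∀ t ∈ Metric.closedBall θ |φ - θ|, 0 < t ∧ |t - θ| ≤ |φ - θ| := by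
    intro t ht
    rw [Metric.mem_closedBall, Real.dist_eq] at ht
    refine ⟨?_, ht⟩
    have := (abs_le.mp ht).1
    have := min_le_right δ₁ θ
    linarith
  have hder : ∀ t ∈ Metric.closedBall θ |φ - θ|, HasDerivWithinAt g
      (deriv logGamma t - deriv logGamma θ - J * (t - θ)) (Metric.closedBall θ |φ - θ|) t := by
    intro t ht
    have h4 := (analyticAt_logGamma (hseg t ht).1).differentiableAt.hasDerivAt
    have h5 : HasDerivAt (fun t : ℝ => t - θ) 1 t := (hasDerivAt_id t).sub_const θ
    have h6 := ((h4.sub_const (logGamma θ)).sub (h5.const_mul (deriv logGamma θ))).sub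
      ((h5.pow 2).const_mul (J / 2))
    refine (h6.congr_deriv ?_).hasDerivWithinAt
    push_cast
    ring
  have hbound : ∀ t ∈ Metric.closedBall θ |φ - θ|,
      ‖deriv logGamma t - deriv logGamma θ - J * (t - θ)‖ ≤ ε * |φ - θ| := by
    intro t ht
    have h4 : dist t θ < δ₁ := by
      rw [Real.dist_eq]
      exact ((hseg t ht).2.trans_lt hφδ).trans_le (min_le_left _ _)
    have h5 := hball h4
    rw [smul_eq_mul, mul_comm (t - θ)] at h5
    refine h5.trans ?_
    rw [Real.norm_eq_abs]
    exact mul_le_mul_of_nonneg_left (hseg t ht).2 hε.le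
  have hmvt := Convex.norm_image_sub_le_of_norm_hasDerivWithin_le hder hbound
    (convex_closedBall θ |φ - θ|) (x := θ) (y := φ) (by simp)
    (by rw [Metric.mem_closedBall, Real.dist_eq])
  have hg0 : g θ = 0 := by simp [hg]
  rw [hg0, sub_zero, Real.norm_eq_abs, Real.norm_eq_abs, mul_assoc, ← sq, sq_abs] at hmvt
  rw [klLoss_of_pos θ hφ]
  exact hmvt

/-- The contribution of small estimates to the loss. -/
def smallLoss (c φ : ℝ) : ℝ := if φ < c then max (Real.log φ⁻¹) 0 else 0

lemma smallLoss_nonneg (c φ : ℝ) : 0 ≤ smallLoss c φ := by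
  unfold smallLoss
  split_ifs
  · exact le_max_right _ _
  · exact le_rfl

lemma logGamma_le_zero {t : ℝ} (h1 : 1 ≤ t) (h2 : t ≤ 2) : logGamma t ≤ 0 := by
  have h := strictConvexOn_logGamma.convexOn.le_max_of_mem_Icc (x := 1) (y := 2) (z := t)
    (by simp) (by simp) ⟨h1, h2⟩
  simpa [logGamma, Real.Gamma_two] using h

/-- Near 0, Γ(φ) = Γ(φ+1)/φ with Γ(φ+1) ≤ 1; on [1,2], Γ ≤ 1; beyond 2, Γ(φ) ≤ n! ≤ nⁿ with n = ⌈φ⌉.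
Only the singularity at 0 escapes a quadratic bound, which is what the third hypothesis controls. -/
lemma logGamma_le {c φ : ℝ} (hc : 0 < c) (hφ : 0 < φ) :
    logGamma φ ≤ smallLoss c φ + |Real.log c| + (φ + 1) ^ 2 := by
  have hs := smallLoss_nonneg c φ
  have habs := abs_nonneg (Real.log c)
  rcases le_total φ 1 with h1 | h1
  · have h2 : logGamma φ = logGamma (φ + 1) - Real.log φ := by
      rw [logGamma, logGamma, Real.Gamma_add_one hφ.ne', Real.log_mul hφ.ne'
        (Real.Gamma_pos_of_pos hφ).ne']
      ring
    have h3 : logGamma (φ + 1) ≤ 0 := logGamma_le_zero (by linarith) (by linarith)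
    have h4 : -Real.log φ ≤ smallLoss c φ + |Real.log c| := by
      by_cases hφc : φ < c
      · rw [smallLoss, if_pos hφc, Real.log_inv]
        have := le_max_left (-Real.log φ) 0
        linarith
      · have h5 := Real.log_le_log hc (not_lt.mp hφc)
        have h6 := neg_abs_le (Real.log c)
        linarith
    have := sq_nonneg (φ + 1)
    linarith
  · rcases le_total φ 2 with h2 | h2
    · have := logGamma_le_zero h1 h2
      have := sq_nonneg (φ + 1)
      linarith
    · have h3 : logGamma φ ≤ (φ + 1) ^ 2 := by
        set n := ⌈φ⌉₊ with hn
        have hn1 : φ ≤ n := Nat.le_ceil φ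
        have hn2 : (n : ℝ) ≤ φ + 1 := (Nat.ceil_lt_add_one hφ.le).le
        have hnpos : (0 : ℝ) < n := by linarith
        have h4 : Real.Gamma φ ≤ Real.Gamma ((n : ℝ) + 1) :=
          Real.Gamma_strictMonoOn_Ici.monotoneOn h2 (by simp only [Set.mem_Ici]; linarith)
            (by linarith)
        rw [Real.Gamma_nat_eq_factorial] at h4
        have h5 : ((n.factorial : ℕ) : ℝ) ≤ (n : ℝ) ^ n := by
          exact_mod_cast Nat.factorial_le_pow n
        have h6 : logGamma φ ≤ Real.log ((n : ℝ) ^ n) :=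
          Real.log_le_log (Real.Gamma_pos_of_pos hφ) (h4.trans h5)
        rw [Real.log_pow] at h6
        have h7 := Real.log_le_sub_one_of_pos hnpos
        nlinarith
      linarith

/-- At distance at least δ, constants and linear terms are absorbed into a multiple of (φ-θ)². -/
lemma exists_klLoss_le_of_far {θ c δ : ℝ} (hc : 0 < c) (hδ : 0 < δ) :
    ∃ K, 0 ≤ K ∧ ∀ φ, 0 < φ → δ ≤ |φ - θ| → klLoss θ φ ≤ K * (φ - θ) ^ 2 + smallLoss c φ := by
  set A := |Real.log c| + |logGamma θ| + 2 * (θ + 1) ^ 2 with hA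
  have hA0 : 0 ≤ A := by positivity
  set B := |deriv logGamma θ| with hB
  have hB0 : 0 ≤ B := abs_nonneg _
  refine ⟨2 + A / δ ^ 2 + B / δ, by positivity, fun φ hφ hfar => ?_⟩
  rw [klLoss_of_pos θ hφ]
  have h1 := logGamma_le hc hφ
  have h2 : (φ + 1) ^ 2 ≤ 2 * (φ - θ) ^ 2 + 2 * (θ + 1) ^ 2 := by
    nlinarith [sq_nonneg (φ - θ - (θ + 1))]
  have h3 : 1 ≤ (φ - θ) ^ 2 / δ ^ 2 := by
    rw [one_le_div (by positivity), ← sq_abs (φ - θ)]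
    gcongr
  have h4 : |φ - θ| ≤ (φ - θ) ^ 2 / δ := by
    rw [le_div_iff₀ hδ, ← sq_abs (φ - θ), sq]
    gcongr
  have h5 : -(deriv logGamma θ * (φ - θ)) ≤ B * ((φ - θ) ^ 2 / δ) := by
    refine (neg_le_abs _).trans ?_
    rw [abs_mul]
    gcongr
  have h6 : A ≤ A * ((φ - θ) ^ 2 / δ ^ 2) := le_mul_of_one_le_right hA0 h3
  have h7 := neg_abs_le (logGamma θ)
  have h8 : (2 + A / δ ^ 2 + B / δ) * (φ - θ) ^ 2
      = 2 * (φ - θ) ^ 2 + A * ((φ - θ) ^ 2 / δ ^ 2) + B * ((φ - θ) ^ 2 / δ) := by ring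
  rw [h8]
  linarith

/-- Global quadratic bound for the loss. -/
lemma exists_klLoss_le {θ c : ℝ} (hθ : 0 < θ) (hc : 0 < c) :
    ∃ K, 0 ≤ K ∧ ∀ φ, 0 < φ → klLoss θ φ ≤ K * (φ - θ) ^ 2 + smallLoss c φ := by
  obtain ⟨δ, hδ, hnear⟩ := exists_abs_klLoss_sub_le_of_near hθ one_pos
  obtain ⟨K, hK, hfar⟩ := exists_klLoss_le_of_far (θ := θ) hc hδ
  have hJ := iteratedDeriv_two_logGamma_pos hθ
  refine ⟨K + (iteratedDeriv 2 logGamma θ / 2 + 1), by positivity, fun φ hφ => ?_⟩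
  have hs := smallLoss_nonneg c φ
  have hsq := sq_nonneg (φ - θ)
  rcases lt_or_ge |φ - θ| δ with h | h
  · have h1 := (abs_le.mp (hnear φ hφ h)).2
    have := mul_nonneg hK hsq
    linarith
  · have h1 := hfar φ hφ h
    have : 0 ≤ (iteratedDeriv 2 logGamma θ / 2 + 1) * (φ - θ) ^ 2 := by positivity
    linarith

/-- Second order expansion of the loss with a global remainder. -/
lemma exists_abs_klLoss_sub_le {θ c : ℝ} (hθ : 0 < θ) (hc : 0 < c) {ε : ℝ} (hε : 0 < ε) :
    ∃ K, 0 ≤ K ∧ ∀ φ, 0 < φ →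
      |klLoss θ φ - iteratedDeriv 2 logGamma θ / 2 * (φ - θ) ^ 2|
        ≤ ε * (φ - θ) ^ 2 + K * (φ - θ) ^ 4 + smallLoss c φ := by
  obtain ⟨δ, hδ, hnear⟩ := exists_abs_klLoss_sub_le_of_near hθ hε
  obtain ⟨K, hK, hglob⟩ := exists_klLoss_le hθ hc
  have hJ := iteratedDeriv_two_logGamma_pos hθ
  set J := iteratedDeriv 2 logGamma θ
  refine ⟨(K + J / 2) / δ ^ 2, by positivity, fun φ hφ => ?_⟩
  have hs := smallLoss_nonneg c φ
  rcases lt_or_ge |φ - θ| δ with h | h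
  · have h1 := hnear φ hφ h
    have : 0 ≤ (K + J / 2) / δ ^ 2 * (φ - θ) ^ 4 := by positivity
    linarith
  · have h1 := hglob φ hφ
    have h2 := klLoss_nonneg hθ φ
    have h3 : 1 ≤ (φ - θ) ^ 2 / δ ^ 2 := by
      rw [one_le_div (by positivity), ← sq_abs (φ - θ)]
      gcongr
    -- Away from θ the quadratic error is turned into a quartic one, whose expectation is O(n⁻²) and
    -- so summable.
    have h4 : (K + J / 2) * (φ - θ) ^ 2 ≤ (K + J / 2) / δ ^ 2 * (φ - θ) ^ 4 := by
      have h5 : (K + J / 2) / δ ^ 2 * (φ - θ) ^ 4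
          = (K + J / 2) * (φ - θ) ^ 2 * ((φ - θ) ^ 2 / δ ^ 2) := by ring
      rw [h5]
      exact le_mul_of_one_le_right (by positivity) h3
    have h5 : 0 ≤ ε * (φ - θ) ^ 2 := by positivity
    have h6 : 0 ≤ J / 2 * (φ - θ) ^ 2 := by positivity
    have h7 : 0 ≤ K * (φ - θ) ^ 2 := by positivity
    rw [abs_le]
    constructor <;> linarith

/-! ### Harmonic sums -/

lemma log_le_sum_inv_succ {m : ℕ} (hm : 1 ≤ m) :
    Real.log m ≤ ∑ i ∈ Finset.range m, ((i : ℝ) + 1)⁻¹ := by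
  have h := log_add_one_le_harmonic m
  have h2 : Real.log m ≤ Real.log ((m + 1 : ℕ) : ℝ) :=
    Real.log_le_log (by exact_mod_cast hm) (by push_cast; linarith)
  refine h2.trans (h.trans (le_of_eq ?_))
  simp [harmonic]

lemma exists_abs_sum_sub_log_le {a : ℕ → ℝ} {l : ℝ} (hl : 0 ≤ l)
    (h : ∀ ε, 0 < ε → ∃ ζ : ℕ → ℝ, Summable ζ ∧ (∀ i, 0 ≤ ζ i) ∧
      ∀ i, |a i - l * ((i : ℝ) + 1)⁻¹| ≤ ε * ((i : ℝ) + 1)⁻¹ + ζ i) {ε : ℝ} (hε : 0 < ε) :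
    ∃ M, ∀ m : ℕ, 1 ≤ m →
      |∑ i ∈ Finset.range m, a i - l * Real.log m| ≤ ε * Real.log m + M := by
  obtain ⟨ζ, hζ, hζ0, hb⟩ := h ε hε
  refine ⟨ε + ∑' i, ζ i + l, fun m hm => ?_⟩
  have h1 := log_le_sum_inv_succ hm
  have h2 := sum_inv_succ_le_one_add_log m
  set H := ∑ i ∈ Finset.range m, ((i : ℝ) + 1)⁻¹ with hH
  have h3 : |∑ i ∈ Finset.range m, a i - l * H| ≤ ε * H + ∑' i, ζ i := by
    rw [hH, Finset.mul_sum, ← Finset.sum_sub_distrib]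
    refine (Finset.abs_sum_le_sum_abs _ _).trans ((Finset.sum_le_sum fun i _ => hb i).trans ?_)
    rw [Finset.sum_add_distrib, ← Finset.mul_sum]
    gcongr
    exact hζ.sum_le_tsum _ fun i _ => hζ0 i
  have h4 : ε * H ≤ ε * (1 + Real.log m) := by gcongr
  have h5 : l * H ≤ l * (1 + Real.log m) := by gcongr
  have h6 : l * Real.log m ≤ l * H := by gcongr
  rw [abs_le] at h3 ⊢
  constructor <;> linarith [h3.1, h3.2]

lemma summable_inv_succ_sq : Summable fun i : ℕ => (((i : ℝ) + 1) ^ 2)⁻¹ := by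
  have h := (summable_nat_add_iff 1).mpr (Real.summable_nat_pow_inv.mpr (by norm_num : 1 < 2))
  simpa using h

/-- The asymptotic relation fails to give the bound at finitely many indices only; they go into ξ,
which has finite support. -/
lemma exists_summable_of_isEquivalent {v : ℕ → ℝ} {l : ℝ} (hl : 0 < l)
    (hv : v ~[atTop] fun n : ℕ => l * (n : ℝ)⁻¹) {ε : ℝ} (hε : 0 < ε) :
    ∃ ξ : ℕ → ℝ, Summable ξ ∧ (∀ i, 0 ≤ ξ i) ∧
      ∀ i : ℕ, |v (i + 1) - l * ((i : ℝ) + 1)⁻¹| ≤ ε * ((i : ℝ) + 1)⁻¹ + ξ i := by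
  have h := hv.isLittleO.def (c := ε / l) (by positivity)
  obtain ⟨n₀, hn₀⟩ := eventually_atTop.mp h
  refine ⟨fun i => if i < n₀ then |v (i + 1) - l * ((i : ℝ) + 1)⁻¹| else 0, ?_, fun i => ?_,
    fun i => ?_⟩
  · refine summable_of_ne_finset_zero (s := Finset.range n₀) fun i hi => if_neg ?_
    simpa using hi
  · simp only
    split_ifs
    · exact abs_nonneg _
    · exact le_rfl
  · have hi : 0 ≤ ε * ((i : ℝ) + 1)⁻¹ := by positivity
    simp only
    split_ifs with hlt
    · linarith
    · have h1 := hn₀ (i + 1) (by omega)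
      simp only [Pi.sub_apply, Nat.cast_add, Nat.cast_one, Real.norm_eq_abs] at h1
      rw [abs_of_pos (show 0 < l * ((i : ℝ) + 1)⁻¹ by positivity)] at h1
      have h2 : ε / l * (l * ((i : ℝ) + 1)⁻¹) = ε * ((i : ℝ) + 1)⁻¹ := by field_simp
      linarith

/-! ### The filtration of the observations -/

lemma comap_le_past (X : ℕ → Ω → ℝ) {k n : ℕ} (hk : 1 ≤ k) (hkn : k < n) :
    MeasurableSpace.comap (X k) inferInstance ≤ past X n :=
  le_iSup₂_of_le k (Finset.mem_Ico.mpr ⟨hk, hkn⟩) le_rfl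

lemma past_mono (X : ℕ → Ω → ℝ) : Monotone (past X) := by
  intro m n hmn
  refine iSup₂_le fun k hk => ?_
  rw [Finset.mem_Ico] at hk
  exact comap_le_past X hk.1 (hk.2.trans_le hmn)

/-- The filtration whose `i`-th term is generated by the first `i` observations. -/
def pastFiltration [mΩ : MeasurableSpace Ω] (X : ℕ → Ω → ℝ)
    (hX : ∀ n : ℕ, 1 ≤ n → Measurable (X n)) : Filtration ℕ mΩ where
  seq i := past X (i + 1)
  mono' _ _ hij := past_mono X (Nat.succ_le_succ hij)
  le' _ := iSup₂_le fun k hk => (hX k (Finset.mem_Ico.mp hk).1).comap_le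

lemma indep_past [MeasurableSpace Ω] {μ : Measure Ω} {X : ℕ → Ω → ℝ}
    (hX : ∀ n : ℕ, 1 ≤ n → Measurable (X n))
    (hindep : iIndepFun (fun n : ℕ => X (n + 1)) μ) (i : ℕ) :
    Indep (MeasurableSpace.comap (X (i + 1)) inferInstance) (past X (i + 1)) μ := by
  have h := indep_iSup_of_disjoint (fun n => (hX (n + 1) (by omega)).comap_le) hindep.iIndep
    (S := {i}) (T := {j | j < i}) (by simp)
  refine indep_of_indep_of_le_left (indep_of_indep_of_le_right h ?_) ?_
  · refine iSup₂_le fun k hk => ?_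
    rw [Finset.mem_Ico] at hk
    obtain ⟨j, rfl⟩ : ∃ j, k = j + 1 := ⟨k - 1, by omega⟩
    exact le_iSup₂_of_le j (show j < i by omega) le_rfl
  · exact le_iSup₂_of_le i rfl le_rfl

/-! ### Moment bounds -/

/-- An exponential Markov bound: exp((θ/2)|log X|) is integrable because X has moments of orders
±θ/2. -/
lemma exists_setIntegral_abs_add_mul_log_le {θ : ℝ} (hθ : 0 < θ) (α a : ℝ) :
    ∃ ρ K, 0 < ρ ∧ 0 ≤ K ∧ ∀ u,
      ∫ x in {x | u < |α + a * Real.log x|}, |α + a * Real.log x| ∂(gammaMeasure θ 1)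
        ≤ K * Real.exp (-(ρ * u)) := by
  have := isProbabilityMeasure_gammaMeasure hθ one_pos
  set ρ := θ / (4 * (|a| + 1)) with hρ
  have hρpos : 0 < ρ := by positivity
  have hs : Integrable (fun x => Real.exp (θ / 2 * |Real.log x|)) (gammaMeasure θ 1) :=
    integrable_exp_mul_abs (integrable_exp_mul_log hθ (by linarith))
      (integrable_exp_mul_log hθ (by linarith))
  set E := ∫ x, Real.exp (θ / 2 * |Real.log x|) ∂(gammaMeasure θ 1) with hE
  have hE0 : 0 ≤ E := integral_nonneg fun x => (Real.exp_pos _).le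
  refine ⟨ρ, ρ⁻¹ * Real.exp (2 * ρ * |α|) * E, hρpos, by positivity, fun u => ?_⟩
  have hm : Measurable fun x : ℝ => |α + a * Real.log x| := by fun_prop
  have hT : MeasurableSet {x : ℝ | u < |α + a * Real.log x|} := measurableSet_lt measurable_const hm
  have hint : Integrable (fun x => |α + a * Real.log x|) (gammaMeasure θ 1) :=
    ((integrable_const α).add ((integrable_log_gammaMeasure hθ).const_mul a)).abs
  set k := ρ⁻¹ * Real.exp (2 * ρ * |α|) * Real.exp (-(ρ * u)) with hk
  have hpt : ∀ x ∈ {x : ℝ | u < |α + a * Real.log x|},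
      |α + a * Real.log x| ≤ k * Real.exp (θ / 2 * |Real.log x|) := by
    intro x hx
    set V := |α + a * Real.log x| with hV
    have hxu : u < V := hx
    have h1 : V ≤ ρ⁻¹ * Real.exp (ρ * V) := by
      rw [le_inv_mul_iff₀ hρpos]
      linarith [Real.add_one_le_exp (ρ * V)]
    have h2 : V ≤ |α| + |a| * |Real.log x| := by
      rw [hV, ← abs_mul]
      exact abs_add_le _ _
    have h3 : 2 * ρ * |a| ≤ θ / 2 := by
      have h4 : 2 * ρ * |a| = θ / 2 * (|a| / (|a| + 1)) := by
        rw [hρ]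
        field_simp
        ring
      rw [h4]
      refine mul_le_of_le_one_right (by positivity) ?_
      rw [div_le_one (by positivity)]
      linarith
    -- On V > u one has ρV ≤ 2ρV - ρu; ρ was chosen so that 2ρ|a| ≤ θ/2.
    have h5 : ρ * V ≤ 2 * ρ * |α| + -(ρ * u) + θ / 2 * |Real.log x| := by
      have h6 := mul_le_mul_of_nonneg_left h2 (by positivity : 0 ≤ 2 * ρ)
      have h7 := mul_le_mul_of_nonneg_right h3 (abs_nonneg (Real.log x))
      have h8 := mul_le_mul_of_nonneg_left hxu.le hρpos.le
      nlinarith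
    calc V ≤ ρ⁻¹ * Real.exp (ρ * V) := h1
      _ ≤ ρ⁻¹ * Real.exp (2 * ρ * |α| + -(ρ * u) + θ / 2 * |Real.log x|) := by gcongr
      _ = k * Real.exp (θ / 2 * |Real.log x|) := by
        rw [Real.exp_add, Real.exp_add, hk]
        ring
  have hk0 : 0 ≤ k := by positivity
  calc ∫ x in {x | u < |α + a * Real.log x|}, |α + a * Real.log x| ∂(gammaMeasure θ 1)
      ≤ ∫ x in {x | u < |α + a * Real.log x|},
          k * Real.exp (θ / 2 * |Real.log x|) ∂(gammaMeasure θ 1) :=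
        setIntegral_mono_on hint.integrableOn (hs.const_mul k).integrableOn hT hpt
    _ ≤ ∫ x, k * Real.exp (θ / 2 * |Real.log x|) ∂(gammaMeasure θ 1) :=
        setIntegral_le_integral (hs.const_mul k) (ae_of_all _ fun x => by positivity)
    _ = _ := by
        rw [integral_const_mul, hk]
        ring

section Estimates

variable [MeasurableSpace Ω] {μ : Measure Ω}

/-- Control of a sequence dominated by a controlled one up to a summable error. -/
lemma TailControl.of_le {g h q : ℕ → Ω → ℝ} {C K : ℝ} (hK : 0 < K)
    (H : TailControl μ h C fun _ => 0)
    (hg0 : ∀ i ω, 0 ≤ g i ω) (hg : ∀ i, Measurable (g i)) (hq0 : ∀ i ω, 0 ≤ q i ω)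
    (hq : ∀ i, Integrable (q i) μ) (hqs : Summable fun i => ∫ ω, q i ω ∂μ)
    (hle : ∀ i, ∀ᵐ ω ∂μ, g i ω ≤ K * h i ω + q i ω) :
    TailControl μ g (K ^ 2 * C) fun i => ∫ ω, q i ω ∂μ := by
  have hgi : ∀ i, Integrable (g i) μ := fun i => by
    refine Integrable.mono' (((H.integrable i).const_mul K).add (hq i))
      (hg i).aestronglyMeasurable ?_
    filter_upwards [hle i] with ω hω
    rwa [Real.norm_of_nonneg (hg0 i ω)]
  refine ⟨mul_nonneg (sq_nonneg K) H.C_nonneg, fun i => integral_nonneg (hq0 i), hqs, hg0, hgi,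
    fun i s r hs hr => ?_⟩
  have h1 : ∫ ω in s, g i ω ∂μ ≤ ∫ ω in s, (K * h i ω + q i ω) ∂μ :=
    integral_mono_ae (hgi i).integrableOn
      (((H.integrable i).const_mul K).add (hq i)).integrableOn (ae_restrict_of_ae (hle i))
  rw [integral_add ((H.integrable i).const_mul K).integrableOn (hq i).integrableOn,
    integral_const_mul] at h1
  -- Rescaling r by K leaves the coefficient of the mass equal to r and turns C into K²C.
  have h2 := H.setIntegral_le i s (r / K) hs (by positivity)
  have h3 := mul_le_mul_of_nonneg_left h2 hK.le
  have h4 : ∫ ω in s, q i ω ∂μ ≤ ∫ ω, q i ω ∂μ :=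
    MeasureTheory.setIntegral_le_integral (hq i) (ae_of_all _ (hq0 i))
  have h5 : K * (r / K * μ.real s + C / (r / K * ((i : ℝ) + 1) ^ 2) + 0)
      = r * μ.real s + K ^ 2 * C / (r * ((i : ℝ) + 1) ^ 2) := by
    field_simp
    ring
  linarith

variable [IsProbabilityMeasure μ]

lemma integrable_sq_of_integrable_pow_four {f : Ω → ℝ} (hf : Measurable f)
    (h4 : Integrable (fun ω => f ω ^ 4) μ) : Integrable (fun ω => f ω ^ 2) μ := by
  refine Integrable.mono' ((integrable_const (1 : ℝ)).add h4)
    (hf.pow_const 2).aestronglyMeasurable (ae_of_all _ fun ω => ?_)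
  rw [Real.norm_of_nonneg (sq_nonneg _)]
  simp only [Pi.add_apply]
  nlinarith [sq_nonneg (f ω ^ 2 - 1), sq_nonneg (f ω)]

lemma setIntegral_sq_le {f : Ω → ℝ} (hf : Measurable f)
    (h4 : Integrable (fun ω => f ω ^ 4) μ) (s : Set Ω) {r : ℝ} (hr : 0 < r) :
    ∫ ω in s, f ω ^ 2 ∂μ ≤ r * μ.real s + r⁻¹ * ∫ ω, f ω ^ 4 ∂μ := by
  have h1 := PerturbedWalk.setIntegral_abs_le ((memLp_two_iff_integrable_sq
    (hf.pow_const 2).aestronglyMeasurable).2 (by simpa only [← pow_mul] using h4))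
    (Set.subset_univ s) hr
  have h3 : ∀ ω, |f ω ^ 2| = f ω ^ 2 := fun ω => abs_of_nonneg (sq_nonneg _)
  have h5 : ∀ ω, (f ω ^ 2) ^ 2 = f ω ^ 4 := fun ω => by ring
  simpa only [h3, h5, setIntegral_univ] using h1

/-- Where the fourth moment hypothesis enters, through e² ≤ r + e⁴/r. The sequence η is arbitrary so
that error and loss can share one. -/
lemma tailControl_sq {e : ℕ → Ω → ℝ} {C : ℝ} (hC : 0 ≤ C) (he : ∀ i, Measurable (e i))
    (h4 : ∀ i, Integrable (fun ω => e i ω ^ 4) μ)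
    (hle : ∀ i : ℕ, ∫ ω, e i ω ^ 4 ∂μ ≤ C * (((i : ℝ) + 1) ^ 2)⁻¹) {η : ℕ → ℝ}
    (hη0 : ∀ i, 0 ≤ η i) (hη : Summable η) :
    TailControl μ (fun i ω => e i ω ^ 2) C η where
  C_nonneg := hC
  η_nonneg := hη0
  summable_η := hη
  nonneg _ _ := sq_nonneg _
  integrable i := integrable_sq_of_integrable_pow_four (he i) (h4 i)
  setIntegral_le i s r _ hr := by
    have h1 := setIntegral_sq_le (he i) (h4 i) s hr
    have h2 := mul_le_mul_of_nonneg_left (hle i) (inv_pos.mpr hr).le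
    have h3 : r⁻¹ * (C * (((i : ℝ) + 1) ^ 2)⁻¹) = C / (r * ((i : ℝ) + 1) ^ 2) := by
      field_simp
    have := hη0 i
    linarith

end Estimates

/-! ### The log likelihood ratio as a perturbed walk. -/

section Walk

variable [MeasurableSpace Ω] {μ : Measure Ω}

lemma measurable_smallLoss (c : ℝ) : Measurable (smallLoss c) :=
  Measurable.ite measurableSet_Iio ((measurable_id.inv.log).max measurable_const) measurable_const

lemma integrable_smallLoss {c : ℝ} {est : ℕ → Ω → ℝ} (hest : ∀ i, Measurable (est (i + 1)))
    (hsum : ∑' n : ℕ, ∫⁻ ω in {ω | est (n + 1) ω < c},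
      ENNReal.ofReal (max (Real.log (est (n + 1) ω)⁻¹) 0) ∂μ < ∞) :
    (∀ i, Integrable (fun ω => smallLoss c (est (i + 1) ω)) μ) ∧
      Summable fun i => ∫ ω, smallLoss c (est (i + 1) ω) ∂μ := by
  have hmeas : ∀ i, Measurable fun ω => smallLoss c (est (i + 1) ω) :=
    fun i => (measurable_smallLoss c).comp (hest i)
  have h1 : ∀ i, ∫⁻ ω, ENNReal.ofReal (smallLoss c (est (i + 1) ω)) ∂μ
      = ∫⁻ ω in {ω | est (i + 1) ω < c},
        ENNReal.ofReal (max (Real.log (est (i + 1) ω)⁻¹) 0) ∂μ := by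
    intro i
    rw [← lintegral_indicator (measurableSet_lt (hest i) measurable_const)]
    refine lintegral_congr fun ω => ?_
    by_cases h : est (i + 1) ω < c <;> simp [smallLoss, h, Set.indicator]
  have h2 : ∀ i, ∫⁻ ω, ENNReal.ofReal (smallLoss c (est (i + 1) ω)) ∂μ ≠ ∞ := by
    intro i
    rw [h1 i]
    exact ENNReal.ne_top_of_tsum_ne_top hsum.ne i
  refine ⟨fun i => ⟨(hmeas i).aestronglyMeasurable, ?_⟩, ?_⟩
  · rw [hasFiniteIntegral_iff_ofReal (ae_of_all _ fun ω => smallLoss_nonneg c _)]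
    exact (h2 i).lt_top
  · have h3 : ∀ i, ∫ ω, smallLoss c (est (i + 1) ω) ∂μ
        = (∫⁻ ω in {ω | est (i + 1) ω < c},
          ENNReal.ofReal (max (Real.log (est (i + 1) ω)⁻¹) 0) ∂μ).toReal := by
      intro i
      rw [← h1 i, integral_eq_lintegral_of_nonneg_ae (ae_of_all _ fun ω => smallLoss_nonneg c _)
        (hmeas i).aestronglyMeasurable]
    simp_rw [h3]
    exact ENNReal.summable_toReal hsum.ne

variable [IsProbabilityMeasure μ]

/-- The logarithm of the likelihood ratio with estimated parameter is a perturbed walk. -/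
lemma exists_perturbedWalk {X est : ℕ → Ω → ℝ} {θ θ₀ κ c : ℝ}
    (hX : ∀ n : ℕ, 1 ≤ n → Measurable (X n)) (hθ : 0 < θ)
    (hlaw : ∀ n : ℕ, 1 ≤ n → μ.map (X n) = gammaMeasure θ 1)
    (hindep : iIndepFun (fun n : ℕ => X (n + 1)) μ) (hθ₀ : 0 < θ₀) (hne : θ ≠ θ₀) (hκ : 0 < κ)
    (hest : ∀ n : ℕ, 1 ≤ n → Measurable[past X n] (est n))
    (hpos : ∀ n : ℕ, 1 ≤ n → ∀ᵐ ω ∂μ, 0 < est n ω)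
    (heff : (fun n : ℕ => ∫ ω, (est n ω - θ) ^ 2 ∂μ) ~[atTop]
      fun n : ℕ => 1 / ((n : ℝ) * iteratedDeriv 2 logGamma θ * κ))
    (h4 : ∀ n : ℕ, 1 ≤ n → Integrable (fun ω => (est n ω - θ) ^ 4) μ)
    (hO : (fun n : ℕ => ∫ ω, (est n ω - θ) ^ 4 ∂μ) =O[atTop] fun n : ℕ => ((n : ℝ) ^ 2)⁻¹)
    (hc : 0 < c)
    (hsum : ∑' n : ℕ, ∫⁻ ω in {ω | est (n + 1) ω < c},
      ENNReal.ofReal (max (Real.log (est (n + 1) ω)⁻¹) 0) ∂μ < ∞) :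
    ∃ w : PerturbedWalk μ,
      (∀ i ω, w.step i ω = klLoss θ θ₀ + (θ - θ₀) * (Real.log (X (i + 1) ω) - deriv logGamma θ)
        + (est (i + 1) ω - θ) * (Real.log (X (i + 1) ω) - deriv logGamma θ)
        - klLoss θ (est (i + 1) ω)) ∧
      w.drift = klLoss θ θ₀ ∧ w.rate = 1 / (2 * κ) := by
  have := isProbabilityMeasure_gammaMeasure hθ one_pos
  set ψ := deriv logGamma θ with hψ
  set J := iteratedDeriv 2 logGamma θ with hJ
  have hJpos : 0 < J := iteratedDeriv_two_logGamma_pos hθ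
  -- Step i of the walk uses observation i+1; as 𝒢 i is generated by X_1, …, X_i, the estimate `est
  -- (i + 1)` is predictable.
  set 𝒢 := pastFiltration X hX with h𝒢
  have hXm : ∀ i, Measurable (X (i + 1)) := fun i => hX (i + 1) (by omega)
  have hesti : ∀ i, Measurable[𝒢 i] (est (i + 1)) := fun i => hest (i + 1) (by omega)
  have hestm : ∀ i, Measurable (est (i + 1)) := fun i => (hesti i).mono (𝒢.le i) le_rfl
  have hXG : ∀ i, Measurable[𝒢 (i + 1)] (X (i + 1)) := fun i =>
    (comap_measurable (X (i + 1))).mono (comap_le_past X (by omega) (by omega)) le_rfl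
  -- transfer of integrals to the Gamma distribution
  have htrans : ∀ (f : ℝ → ℝ), Measurable f → ∀ i,
      ∫ ω, f (X (i + 1) ω) ∂μ = ∫ x, f x ∂(gammaMeasure θ 1) := by
    intro f hf i
    rw [← hlaw (i + 1) (by omega), integral_map (hXm i).aemeasurable hf.aestronglyMeasurable]
  have hlogLp : ∀ i, MemLp (fun ω => Real.log (X (i + 1) ω) - ψ) 2 μ := by
    intro i
    have h1 : MemLp (fun x => Real.log x - ψ) 2 (μ.map (X (i + 1))) := by
      rw [hlaw (i + 1) (by omega)]
      exact (memLp_log_gammaMeasure hθ).sub (memLp_const ψ)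
    exact h1.comp_of_map (hXm i).aemeasurable
  -- the moments of the error
  have hem : ∀ i, Measurable fun ω => est (i + 1) ω - θ := fun i => (hestm i).sub_const θ
  have h4' : ∀ i, Integrable (fun ω => (est (i + 1) ω - θ) ^ 4) μ := fun i => h4 _ (by omega)
  obtain ⟨C₄, hC₄, hbd⟩ := bound_of_isBigO_nat_atTop hO
  have hC₄le : ∀ i : ℕ, ∫ ω, (est (i + 1) ω - θ) ^ 4 ∂μ ≤ C₄ * (((i : ℝ) + 1) ^ 2)⁻¹ := by
    intro i
    have hi : (((i + 1 : ℕ) : ℝ) ^ 2)⁻¹ ≠ 0 := by positivity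
    have h1 := hbd hi
    rw [Real.norm_of_nonneg (integral_nonneg fun ω => by positivity),
      Real.norm_of_nonneg (by positivity)] at h1
    push_cast at h1
    exact h1
  -- the estimates near zero
  obtain ⟨hsi, hss⟩ := integrable_smallLoss hestm hsum
  set η : ℕ → ℝ := fun i => ∫ ω, smallLoss c (est (i + 1) ω) ∂μ with hη
  have hη0 : ∀ i, 0 ≤ η i := fun i => integral_nonneg fun ω => smallLoss_nonneg c _
  obtain ⟨K, hK, hKle⟩ := exists_klLoss_le hθ hc
  have hsq0 : TailControl μ (fun i ω => (est (i + 1) ω - θ) ^ 2) C₄ fun _ => 0 :=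
    tailControl_sq hC₄.le hem h4' hC₄le (fun _ => le_rfl) summable_zero
  -- The constants are weakened to those valid for the loss, since the walk has a single C and η.
  have hsq : TailControl μ (fun i ω => (est (i + 1) ω - θ) ^ 2) ((K + 1) ^ 2 * C₄) η := by
    refine tailControl_sq (by positivity) hem h4' (fun i => (hC₄le i).trans ?_) hη0 hss
    gcongr
    exact le_mul_of_one_le_left hC₄.le (one_le_pow₀ (by linarith))
  have hloss : TailControl μ (fun i ω => klLoss θ (est (i + 1) ω)) ((K + 1) ^ 2 * C₄) η := by
    refine TailControl.of_le (q := fun i ω => smallLoss c (est (i + 1) ω)) (by positivity) hsq0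
      (fun i ω => klLoss_nonneg hθ _) (fun i => (measurable_klLoss θ).comp (hestm i))
      (fun i ω => smallLoss_nonneg c _) hsi hss fun i => ?_
    filter_upwards [hpos (i + 1) (by omega)] with ω hω
    have h1 := hKle _ hω
    have h2 := sq_nonneg (est (i + 1) ω - θ)
    linarith
  have hlossSum : ∀ ε, 0 < ε → ∃ M, ∀ m : ℕ, 1 ≤ m →
      |∑ i ∈ Finset.range m, ∫ ω, klLoss θ (est (i + 1) ω) ∂μ - 1 / (2 * κ) * Real.log m|
        ≤ ε * Real.log m + M := by
    intro ε hε
    refine exists_abs_sum_sub_log_le (by positivity) (fun ε hε => ?_) hε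
    -- The mean squared error is asymptotic to l/n, so half the Fisher information J times l gives
    -- the rate 1/(2κ).
    set l := 1 / (J * κ) with hl
    have hlpos : 0 < l := by positivity
    have heff' : (fun n : ℕ => ∫ ω, (est n ω - θ) ^ 2 ∂μ) ~[atTop]
        fun n : ℕ => l * (n : ℝ)⁻¹ := by
      refine heff.congr_right (Eventually.of_forall fun n => ?_)
      simp only [hl, one_div, mul_inv]
      ring
    obtain ⟨ξ, hξ, hξ0, hv⟩ := exists_summable_of_isEquivalent hlpos heff'
      (ε := ε / (2 * J)) (by positivity)
    -- Up to summable terms, ε₁ times the mean squared error costs ε/2, and the accuracy ε/(2J)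
    -- costs ε/4 after the factor J/2; the total stays below ε.
    set ε₁ := ε / (2 * (l + ε / (2 * J))) with hε₁
    have hε₁pos : 0 < ε₁ := by positivity
    obtain ⟨K₄, hK₄, hexp⟩ := exists_abs_klLoss_sub_le hθ hc hε₁pos
    refine ⟨fun i => (J / 2 + ε₁) * ξ i + (K₄ * C₄ * (((i : ℝ) + 1) ^ 2)⁻¹ + η i),
      (hξ.mul_left _).add ((summable_inv_succ_sq.mul_left _).add hss), fun i => ?_, fun i => ?_⟩
    · have := hξ0 i
      have := hη0 i
      positivity
    · set v := ∫ ω, (est (i + 1) ω - θ) ^ 2 ∂μ with hvdef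
      have hsqi := hsq0.integrable i
      have hli := hloss.integrable i
      have h1 : |∫ ω, klLoss θ (est (i + 1) ω) ∂μ - J / 2 * v|
          ≤ ε₁ * v + K₄ * ∫ ω, (est (i + 1) ω - θ) ^ 4 ∂μ + η i := by
        rw [hvdef, ← integral_const_mul, ← integral_sub hli (hsqi.const_mul _)]
        refine (abs_integral_le_integral_abs).trans ?_
        have i1 : Integrable (fun ω => ε₁ * (est (i + 1) ω - θ) ^ 2
            + K₄ * (est (i + 1) ω - θ) ^ 4) μ := (hsqi.const_mul _).add ((h4' i).const_mul _)
        have h2 : ∫ ω, |klLoss θ (est (i + 1) ω) - J / 2 * (est (i + 1) ω - θ) ^ 2| ∂μ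
            ≤ ∫ ω, (ε₁ * (est (i + 1) ω - θ) ^ 2 + K₄ * (est (i + 1) ω - θ) ^ 4
              + smallLoss c (est (i + 1) ω)) ∂μ := by
          refine integral_mono_ae (hli.sub (hsqi.const_mul _)).abs (i1.add (hsi i)) ?_
          filter_upwards [hpos (i + 1) (by omega)] with ω hω
          exact hexp _ hω
        rw [integral_add i1 (hsi i), integral_add (hsqi.const_mul _) ((h4' i).const_mul _),
          integral_const_mul, integral_const_mul] at h2
        exact h2
      have h2 := hv i
      have h3 := mul_le_mul_of_nonneg_left (hC₄le i) hK₄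
      set x := ((i : ℝ) + 1)⁻¹ with hx
      have h4 : v ≤ (l + ε / (2 * J)) * x + ξ i := by
        have := (abs_le.mp h2).2
        linarith
      have h5 := mul_le_mul_of_nonneg_left h4 hε₁pos.le
      have h6 : ε₁ * ((l + ε / (2 * J)) * x + ξ i) = ε / 2 * x + ε₁ * ξ i := by
        rw [hε₁]
        field_simp
      have h7 : |J / 2 * v - 1 / (2 * κ) * x| ≤ ε / 4 * x + J / 2 * ξ i := by
        have h8 : J / 2 * v - 1 / (2 * κ) * x = J / 2 * (v - l * x) := by
          rw [hl]
          field_simp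
        rw [h8, abs_mul, abs_of_pos (by positivity)]
        refine (mul_le_mul_of_nonneg_left h2 (by positivity)).trans (le_of_eq ?_)
        field_simp
        ring
      have hx0 : 0 ≤ ε / 4 * x := by positivity
      rw [abs_le] at h1 h7 ⊢
      constructor <;> linarith [h1.1, h1.2, h7.1, h7.2]
  obtain ⟨ρ, Kt, hρ, hKt, htail⟩ :=
    exists_setIntegral_abs_add_mul_log_le hθ (klLoss θ θ₀ - (θ - θ₀) * ψ) (θ - θ₀)
  refine ⟨{
    ℱ := 𝒢
    noise := fun i ω => Real.log (X (i + 1) ω) - ψ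
    err := fun i ω => est (i + 1) ω - θ
    loss := fun i ω => klLoss θ (est (i + 1) ω)
    drift := klLoss θ θ₀
    slope := θ - θ₀
    noiseVar := J
    C := (K + 1) ^ 2 * C₄
    K := Kt
    ρ := ρ
    rate := 1 / (2 * κ)
    η := η
    drift_pos := klLoss_pos hθ hθ₀ hne.symm
    ρ_pos := hρ
    K_nonneg := hKt
    rate_nonneg := by positivity
    measurable_noise := fun i => (Real.measurable_log.comp (hXG i)).sub_const ψ
    measurable_err := fun i => (hesti i).sub_const θ
    measurable_loss := fun i => (measurable_klLoss θ).comp (hesti i)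
    indep := fun i => indep_of_indep_of_le_left (indep_past hX hindep i)
      (((Real.measurable_log.comp (comap_measurable (X (i + 1)))).sub_const ψ).comap_le)
    memLp_noise := hlogLp
    integral_noise := fun i => ?_
    integral_noise_sq := fun i => ?_
    lead_tail := fun i u => ?_
    err_sq := hsq
    loss_control := hloss
    loss_sum := hlossSum }, fun i ω => rfl, rfl, rfl⟩
  · rw [htrans (fun x => Real.log x - ψ) (by fun_prop) i,
      integral_sub (integrable_log_gammaMeasure hθ) (integrable_const _), ← deriv_logGamma hθ]
    simp [hψ]
  · rw [htrans (fun x => (Real.log x - ψ) ^ 2) (by fun_prop) i, hJ, iteratedDeriv_two_logGamma hθ]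
  · refine le_trans (le_of_eq ?_) (htail u)
    have h1 : ∀ x : ℝ, klLoss θ θ₀ + (θ - θ₀) * (x - ψ)
        = klLoss θ θ₀ - (θ - θ₀) * ψ + (θ - θ₀) * x := fun x => by ring
    simp_rw [h1]
    have hm : Measurable fun x : ℝ => |klLoss θ θ₀ - (θ - θ₀) * ψ + (θ - θ₀) * Real.log x| := by
      fun_prop
    rw [← hlaw (i + 1) (by omega), setIntegral_map (measurableSet_lt measurable_const hm)
      hm.aestronglyMeasurable (hXm i).aemeasurable]
    rfl

end Walk

/-! ### The stopping time -/

/-- The tail sum τ = ∑_{i ≥ 0} 1(τ > i), valid also when τ = ∞. -/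
lemma toENNReal_iInf_nat (p : ℕ → Prop) :
    (((⨅ n : ℕ, ⨅ _ : 1 ≤ n ∧ p n, (n : ℕ∞)) : ℕ∞) : ℝ≥0∞)
      = ∑' i : ℕ, {i | ∀ n, 1 ≤ n → n ≤ i → ¬p n}.indicator (fun _ => (1 : ℝ≥0∞)) i := by
  classical
  by_cases h : ∃ n, 1 ≤ n ∧ p n
  · set N := Nat.find h with hN
    have h1 : (⨅ n : ℕ, ⨅ _ : 1 ≤ n ∧ p n, (n : ℕ∞)) = N := by
      refine le_antisymm (iInf₂_le N (Nat.find_spec h)) (le_iInf₂ fun n hn => ?_)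
      exact_mod_cast Nat.find_min' h hn
    have h2 : {i | ∀ n, 1 ≤ n → n ≤ i → ¬p n} = {i | i < N} := by
      ext i
      simp only [Set.mem_ofPred_eq]
      constructor
      · intro hi
        by_contra hlt
        exact hi N (Nat.find_spec h).1 (not_lt.mp hlt) (Nat.find_spec h).2
      · intro hi n hn1 hni hpn
        exact Nat.find_min h (lt_of_le_of_lt hni hi) ⟨hn1, hpn⟩
    rw [h1, h2, tsum_eq_sum (s := Finset.range N)]
    · rw [Finset.sum_congr rfl (g := fun _ => (1 : ℝ≥0∞)) fun i hi => by
        rw [Set.indicator_of_mem]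
        exact Finset.mem_range.mp hi]
      simp
    · intro i hi
      rw [Set.indicator_of_notMem]
      simpa using hi
  · have h1 : (⨅ n : ℕ, ⨅ _ : 1 ≤ n ∧ p n, (n : ℕ∞)) = ⊤ := by
      simp only [iInf_eq_top]
      exact fun n hn => absurd ⟨n, hn⟩ h
    have h2 : {i | ∀ n, 1 ≤ n → n ≤ i → ¬p n} = Set.univ := by
      ext i
      simp only [Set.mem_ofPred_eq, Set.mem_univ, iff_true]
      exact fun n hn _ hpn => h ⟨n, hn, hpn⟩
    rw [h1, h2, Set.indicator_univ, ENNReal.tsum_const_eq_top_of_ne_zero one_ne_zero]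
    simp

/-- The logarithm of one factor is (θ_n-θ₀) log X_n + log Γ(θ₀) - log Γ(θ_n); centring log X_n at ψ
and inserting θ splits it into drift, noise, error and loss. -/
lemma likelihoodRatio_eq_exp {θ θ₀ : ℝ} (hθ₀ : 0 < θ₀) {X est : ℕ → Ω → ℝ}
    {ω : Ω} (hXpos : ∀ i, 0 < X (i + 1) ω) (hpos : ∀ i, 0 < est (i + 1) ω) (n : ℕ) :
    likelihoodRatio θ₀ X est n ω = Real.exp (∑ i ∈ Finset.range n,
      (klLoss θ θ₀ + (θ - θ₀) * (Real.log (X (i + 1) ω) - deriv logGamma θ)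
        + (est (i + 1) ω - θ) * (Real.log (X (i + 1) ω) - deriv logGamma θ)
        - klLoss θ (est (i + 1) ω))) := by
  induction n with
  | zero => simp [likelihoodRatio]
  | succ n ih =>
    have h1 : likelihoodRatio θ₀ X est (n + 1) ω = likelihoodRatio θ₀ X est n ω *
        ((X (n + 1) ω) ^ (est (n + 1) ω - θ₀) * Real.Gamma θ₀ / Real.Gamma (est (n + 1) ω)) :=
      Finset.prod_Icc_succ_top (by omega) _
    rw [h1, ih, Finset.sum_range_succ, Real.exp_add]
    congr 1
    have hΓ₀ := Real.Gamma_pos_of_pos hθ₀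
    have hΓ := Real.Gamma_pos_of_pos (hpos n)
    have hX := hXpos n
    rw [← Real.exp_log (show 0 < X (n + 1) ω ^ (est (n + 1) ω - θ₀) * Real.Gamma θ₀
      / Real.Gamma (est (n + 1) ω) by positivity)]
    congr 1
    rw [Real.log_div (by positivity) hΓ.ne', Real.log_mul (by positivity) hΓ₀.ne',
      Real.log_rpow hX, klLoss_of_pos θ hθ₀, klLoss_of_pos θ (hpos n)]
    simp only [logGamma]
    ring

lemma expectedStoppingTime_eq [MeasurableSpace Ω] {μ : Measure Ω} [IsProbabilityMeasure μ]
    (w : PerturbedWalk μ) {θ₀ : ℝ} {X est : ℕ → Ω → ℝ}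
    (h : ∀ᵐ ω ∂μ, ∀ n, likelihoodRatio θ₀ X est n ω = Real.exp (w.walk n ω)) (b : ℝ) :
    expectedStoppingTime μ θ₀ X est b = ENNReal.ofReal (∑' i, μ.real (w.below b i)) := by
  have h1 : expectedStoppingTime μ θ₀ X est b
      = ∫⁻ ω, ∑' i, (w.below b i).indicator (fun _ => (1 : ℝ≥0∞)) ω ∂μ := by
    refine lintegral_congr_ae ?_
    filter_upwards [h] with ω hω
    rw [stoppingTime, toENNReal_iInf_nat]
    refine tsum_congr fun i => ?_
    have h2 : (i ∈ {i | ∀ n, 1 ≤ n → n ≤ i → ¬Real.exp b ≤ likelihoodRatio θ₀ X est n ω})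
        ↔ ω ∈ w.below b i := by
      simp only [Set.mem_ofPred_eq, PerturbedWalk.below, hω, Real.exp_le_exp, not_le]
    by_cases hi : ω ∈ w.below b i
    · rw [Set.indicator_of_mem hi, Set.indicator_of_mem (h2.2 hi)]
    · rw [Set.indicator_of_notMem hi, Set.indicator_of_notMem fun h' => hi (h2.1 h')]
  rw [h1, lintegral_tsum fun i =>
    (measurable_const.indicator (w.measurableSet_below' b i)).aemeasurable,
    ENNReal.ofReal_tsum_of_nonneg (fun _ => measureReal_nonneg) (w.summable_below b)]
  refine tsum_congr fun i => ?_
  rw [lintegral_indicator (w.measurableSet_below' b i)]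
  simp [measureReal_def]

end GammaShape

end

theorem theorem3 {Ω : Type*} [MeasurableSpace Ω]
    -- under `P θ` the observations `X 1, X 2, …` are i.i.d. Gamma(θ, 1)
    (P : ℝ → Measure Ω) (X : ℕ → Ω → ℝ)
    (hX : ∀ n : ℕ, 1 ≤ n → Measurable (X n))
    (hlaw : ∀ θ : ℝ, 0 < θ → ∀ n : ℕ, 1 ≤ n → (P θ).map (X n) = gammaMeasure θ 1)
    (hindep : ∀ θ : ℝ, 0 < θ → iIndepFun (fun n : ℕ => X (n + 1)) (P θ))
    (θ₀ : ℝ) (hθ₀ : 0 < θ₀)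
    -- the estimators `θ_n`, `n ≥ 1`, measurable with respect to `F_{n-1}`
    (est : ℕ → Ω → ℝ)
    (hest : ∀ n : ℕ, 1 ≤ n → Measurable[GammaShape.past X n] (est n))
    (κ : ℝ → ℝ) :
    (∀ θ : ℝ, 0 < θ →
      GammaShape.fisherInfo θ = iteratedDeriv 2 (fun t => Real.log (Real.Gamma t)) θ) ∧
    (∀ θ φ : ℝ, 0 < θ → 0 < φ →
      GammaShape.klInfo θ φ =
        (θ - φ) * deriv (fun t => Real.log (Real.Gamma t)) θ
          - Real.log (Real.Gamma θ / Real.Gamma φ)) ∧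
    ∀ θ : ℝ, 0 < θ → θ ≠ θ₀ → 0 < κ θ →
      (∀ n : ℕ, 1 ≤ n → ∀ᵐ ω ∂(P θ), 0 < est n ω) →
      -- asymptotic efficiency `κ θ`
      ((fun n : ℕ => ∫ ω, (est n ω - θ) ^ 2 ∂(P θ)) ~[atTop]
        fun n : ℕ => 1 / ((n : ℝ) * GammaShape.fisherInfo θ * κ θ)) →
      -- fourth moments: finite, and `O(n⁻²)`
      (∀ n : ℕ, 1 ≤ n → Integrable (fun ω => (est n ω - θ) ^ 4) (P θ)) →
      ((fun n : ℕ => ∫ ω, (est n ω - θ) ^ 4 ∂(P θ)) =O[atTop]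
        fun n : ℕ => ((n : ℝ) ^ 2)⁻¹) →
      -- summability of `E_θ[(log θ_n⁻¹)⁺ 1(θ_n < c)]`
      (∃ c : ℝ, 0 < c ∧
        ∑' n : ℕ, ∫⁻ ω in {ω | est (n + 1) ω < c},
          ENNReal.ofReal (max (Real.log (est (n + 1) ω)⁻¹) 0) ∂(P θ) < ∞) →
      (∀ b : ℝ, GammaShape.expectedStoppingTime (P θ) θ₀ X est b < ∞) ∧
      (fun b : ℝ => (GammaShape.expectedStoppingTime (P θ) θ₀ X est b).toReal
          - (GammaShape.klInfo θ θ₀)⁻¹ * (b + Real.log b / (2 * κ θ)))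
        =o[atTop] fun b : ℝ => Real.log b := by
  refine ⟨fun θ hθ => GammaShape.fisherInfo_eq hθ, fun θ φ hθ hφ => ?_, ?_⟩
  · have hΓ := (Real.Gamma_pos_of_pos hθ).ne'
    have hΓ' := (Real.Gamma_pos_of_pos hφ).ne'
    rw [GammaShape.klInfo_eq hθ hφ, Real.log_div hΓ hΓ']
    rfl
  · intro θ hθ hne hκ hpos heff h4 hO hsum
    obtain ⟨c, hc, hsum⟩ := hsum
    -- Total mass 1 is read off from the law of `X 1`.
    have hprob : IsProbabilityMeasure (P θ) := by
      have h1 := isProbabilityMeasure_gammaMeasure hθ one_pos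
      rw [← hlaw θ hθ 1 le_rfl] at h1
      exact Measure.isProbabilityMeasure_of_map (X 1)
    rw [GammaShape.fisherInfo_eq hθ] at heff
    obtain ⟨w, hstep, hdrift, hrate⟩ := GammaShape.exists_perturbedWalk hX hθ (hlaw θ hθ)
      (hindep θ hθ) hθ₀ hne hκ hest hpos heff h4 hO hc hsum
    have hXpos : ∀ᵐ ω ∂(P θ), ∀ i, 0 < X (i + 1) ω := by
      refine ae_all_iff.2 fun i => ae_of_ae_map (hX (i + 1) (by omega)).aemeasurable ?_
      rw [hlaw θ hθ (i + 1) (by omega)]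
      exact GammaShape.ae_pos_gammaMeasure θ
    have hestpos : ∀ᵐ ω ∂(P θ), ∀ i, 0 < est (i + 1) ω :=
      ae_all_iff.2 fun i => hpos (i + 1) (by omega)
    have hratio : ∀ᵐ ω ∂(P θ), ∀ n,
        GammaShape.likelihoodRatio θ₀ X est n ω = Real.exp (w.walk n ω) := by
      filter_upwards [hXpos, hestpos] with ω h1 h2 n
      rw [GammaShape.likelihoodRatio_eq_exp (θ := θ) hθ₀ h1 h2 n, GammaShape.PerturbedWalk.walk]
      simp_rw [hstep]
    have hexp := GammaShape.expectedStoppingTime_eq w hratio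
    refine ⟨fun b => by rw [hexp b]; exact ENNReal.ofReal_lt_top, ?_⟩
    refine w.isLittleO_crossing.congr_left fun b => ?_
    rw [hexp b, ENNReal.toReal_ofReal (tsum_nonneg fun _ => measureReal_nonneg), hdrift, hrate,
      GammaShape.klInfo_eq_klLoss hθ hθ₀]
    ring
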